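/- For $N\ge 0$ put $(a;q)_N=\prod_{i=0}^{N-1}(1-aq^i)$, and for $N=-M<0$ put $(a;q)_{-M}=\prod_{i=1}^{M}(1-aq^{-i})^{-1}$. Let $n\ge 0$, let $\mathbf k=(k_1,\dots,k_s)$ be $s\ge 0$ positive integers, $|\mathbf k|=k_1+\cdots+k_s$, and let $q$, $x=(x_1,\dots,x_n)$, $z=(z_1,\dots,z_s)$ be indeterminates or, more generally, nonzero elements of a field for which no denominator below vanishes. Then \begin{multline*} \sum_{\sigma\in\{-1,+1\}^n} \prod_{i=1}^n\left(\frac{1-qx_i^{2\sigma_i}}{1-x_i^{2\sigma_i}} \prod_{l=1}^s\frac{1-q^{k_l}z_lx_i^{-\sigma_i}}{1-z_lx_i^{-\sigma_i}}\right) \prod_{1\le i<j\le n}\frac{1-qx_i^{\sigma_i}x_j^{\sigma_j}}{1-x_i^{\sigma_i}x_j^{\sigma_j}}\\ =q^{n|\mathbf k|-\binom{|\mathbf k|}{2}}\,(-q;q)_{n-|\mathbf k|} \prod_{1\le a<b\le s}\frac{(q^{k_b+1}z_az_b;q)_{k_a}}{(qz_az_b;q)_{k_a}} \prod_{a=1}^s\frac{(qz_a^2;q^2)_{k_a}}{(qz_a^2;q)_{k_a}}\\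 \times\sum_{\mathbf m\le\mathbf k}(-1)^{|\mathbf m|}\,c_{\mathbf m}\,q^{(|\mathbf k|-n)|\mathbf m|} \prod_{i=1}^n\prod_{l=1}^s\frac{(qx_iz_l;q)_{m_l}}{(x_iz_l;q)_{m_l}}\,\frac{(qz_l/x_i;q)_{m_l}}{(z_l/x_i;q)_{m_l}}, \end{multline*} where $\mathbf m=(m_1,\dots,m_s)$ runs over the integer vectors with $0\le m_l\le k_l$ for all $l$, $|\mathbf m|=m_1+\cdots+m_s$, and \[ c_{\mathbf m}=\prod_{1\le a<b\le s}\frac{q^{m_a}z_a-q^{m_b}z_b}{z_a-z_b} \prod_{1\le a\le b\le s}\frac{1-q^{m_a+m_b}z_az_b}{1-z_az_b} \prod_{a,b=1}^s\frac{(q^{-k_b}z_a/z_b;q)_{m_a}}{(qz_a/z_b;q)_{m_a}}\,\frac{(z_az_b;q)_{m_a}}{(q^{1+k_b}z_az_b;q)_{m_a}}. \] -/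

import Mathlib

/-- The `q`-shifted factorial `(a; q)_n = (1 - a) (1 - a q) ⋯ (1 - a q ^ (n - 1))`. -/
def qPoch {K : Type*} [Field K] (a q : K) (n : ℕ) : K :=
  ∏ i ∈ Finset.range n, (1 - a * q ^ i)

/-- The `q`-shifted factorial with an integer index: `(a; q)_N = (a; q)_∞ / (a q ^ N; q)_∞`.
For a negative index `N = -M` this is `1 / ((1 - a q ^ (-M)) ⋯ (1 - a q ^ (-1)))`. -/
def qPochInt {K : Type*} [Field K] (a q : K) : ℤ → K
  | Int.ofNat N => qPoch a q N
  | Int.negSucc M => (qPoch (a * q ^ (-((M : ℤ) + 1))) q (M + 1))⁻¹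

/-- The coefficient `c_m` of the multiple sum. -/
def coeffC {K : Type*} [Field K] {s : ℕ} (q : K) (k : Fin s → ℕ) (z : Fin s → K)
    (m : Fin s → ℕ) : K :=
  (∏ a, ∏ b ∈ Finset.Ioi a, (q ^ m a * z a - q ^ m b * z b) / (z a - z b)) *
  (∏ a, ∏ b ∈ Finset.Ici a, (1 - q ^ (m a + m b) * z a * z b) / (1 - z a * z b)) *
  ∏ a, ∏ b,
    (qPoch (q ^ (-(k b : ℤ)) * (z a / z b)) q (m a) / qPoch (q * (z a / z b)) q (m a)) *
    (qPoch (z a * z b) q (m a) / qPoch (q ^ (1 + k b) * (z a * z b)) q (m a))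

/-! Suppose first that every k_l is 1. The left side is a sum over signs of the x's, and the theorem
becomes a duality: up to `dualityConst` it equals a sum of the same shape over signs of the z's
(`sumX_eq_sumZ`). In the two-point weights of that sum the natural variable is q^(1/2) z; `dualArg`
writes out the products so that no square root occurs.

The duality is proved by interpolation. Let one of the z's be a free variable Z and clear the
denominators in Z. With n x's and t other z's, the difference of the two sides is a polynomial in Z
of degree at most 2n + 2t (`clearedDiff`). It vanishes at the 2n points x_i^(±1), where both sides
collapse to the identity for n - 1 x's and t z's, and at the 2t points z_a and (q z_a)⁻¹, where
apparent poles cancel. One more zero is enough: (q x_i)⁻¹ if n > 0, by the same collapse, and 0 if n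
= 0, by induction on t. For n > 0 the identity without z's is read off at Z = 0.

For general multiplicities, z_l is replaced by the block z_l, q z_l, …, q^(k_l - 1) z_l. On the left
the one-point weights telescope to those of the theorem. On the right the weight of a positive q^e
z_l with a negative q^(e+1) z_l is zero, so the negative signs form an initial segment of each
block; the lengths m_l of these segments index the sum over m ≤ k. The products of weights between
and inside blocks are found by recursion on the m_l (`crossPairs_eq`, `innerPairs_eq`) and give c_m.

All this takes place in the fraction field of ℤ[q, x, z], where the parameters are generic. Under
the hypotheses of the theorem no denominator dies on specialisation to K, and the value of a
fraction is well defined (`HasValue.unique`), so the identity carries over, in any characteristic.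
-/

/-- The sum over all choices of signs on `I`, weighted by one-point weights `A` and two-point
weights `G`; a subset `S` of `I` records where the sign is negative. -/
def signSum {K ι : Type*} [Field K] [LinearOrder ι] (I : Finset ι) (A : ι → Bool → K)
    (G : ι → Bool → ι → Bool → K) : K :=
  ∑ S ∈ I.powerset, (∏ i ∈ I, A i (decide (i ∈ S))) *
    ∏ i ∈ I, ∏ j ∈ I with i < j, G i (decide (i ∈ S)) j (decide (j ∈ S))

/-! ### Sums over signs with one-point and two-point weights -/

section signSum

variable {K ι : Type*} [Field K] [LinearOrder ι]

/-- As `f` is symmetric, the order only picks a representative of each unordered pair, so the pairs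
containing `a` can be collected wherever `a` lies. -/
theorem prod_lt_insert {f : ι → ι → K} (hf : ∀ i j, f i j = f j i) {a : ι} {I : Finset ι}
    (ha : a ∉ I) :
    ∏ i ∈ insert a I, ∏ j ∈ insert a I with i < j, f i j =
      (∏ i ∈ I, f a i) * ∏ i ∈ I, ∏ j ∈ I with i < j, f i j := by
  rw [Finset.prod_insert ha]
  have h1 : ∏ j ∈ insert a I with a < j, f a j = ∏ j ∈ I, if a < j then f a j else 1 := by
    rw [Finset.prod_filter, Finset.prod_insert ha]; simp
  have h2 : ∀ i ∈ I, ∏ j ∈ insert a I with i < j, f i j =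
      (if i < a then f i a else 1) * ∏ j ∈ I with i < j, f i j := by
    intro i _
    rw [Finset.prod_filter, Finset.prod_insert ha, Finset.prod_filter]
  rw [h1, Finset.prod_congr rfl h2, Finset.prod_mul_distrib, ← mul_assoc,
    ← Finset.prod_mul_distrib]
  congr 1
  refine Finset.prod_congr rfl fun i hi => ?_
  have hne : i ≠ a := fun h => ha (h ▸ hi)
  rcases lt_or_gt_of_ne hne with h | h
  · simp [h, not_lt_of_gt h, hf i a]
  · simp [h, not_lt_of_gt h]

/-- Once the sign of `a` is fixed, its two-point weights are absorbed into the one-point weights of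
the others, and what remains is again a `signSum`. The collapses at special values of Z rest on
this. -/
theorem signSum_insert {G : ι → Bool → ι → Bool → K} (hG : ∀ i ε j δ, G i ε j δ = G j δ i ε)
    {a : ι} {I : Finset ι} (ha : a ∉ I) (A : ι → Bool → K) :
    signSum (insert a I) A G =
      A a false * signSum I (fun i δ => A i δ * G a false i δ) G +
      A a true * signSum I (fun i δ => A i δ * G a true i δ) G := by
  unfold signSum
  rw [Finset.sum_powerset_insert ha, Finset.mul_sum, Finset.mul_sum]
  congr 1
  · refine Finset.sum_congr rfl fun S hS => ?_
    have haS : a ∉ S := fun h => ha (Finset.mem_powerset.1 hS h)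
    rw [prod_lt_insert (f := fun i j => G i (decide (i ∈ S)) j (decide (j ∈ S)))
      (fun i j => hG _ _ _ _) ha, Finset.prod_insert ha, Finset.prod_mul_distrib]
    simp only [haS, decide_false]
    ring
  · refine Finset.sum_congr rfl fun S hS => ?_
    have hmem : ∀ i ∈ I, decide (i ∈ insert a S) = decide (i ∈ S) := by
      intro i hi
      have hne : i ≠ a := fun h => ha (h ▸ hi)
      simp [hne]
    rw [prod_lt_insert
      (f := fun i j => G i (decide (i ∈ insert a S)) j (decide (j ∈ insert a S)))
      (fun i j => hG _ _ _ _) ha, Finset.prod_insert ha, Finset.prod_mul_distrib]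
    have e1 : ∏ i ∈ I, A i (decide (i ∈ insert a S)) = ∏ i ∈ I, A i (decide (i ∈ S)) :=
      Finset.prod_congr rfl fun i hi => by rw [hmem i hi]
    have e2 : ∏ i ∈ I, G a (decide (a ∈ insert a S)) i (decide (i ∈ insert a S)) =
        ∏ i ∈ I, G a true i (decide (i ∈ S)) :=
      Finset.prod_congr rfl fun i hi => by rw [hmem i hi]; simp
    have e3 : ∏ i ∈ I, ∏ j ∈ I with i < j,
          G i (decide (i ∈ insert a S)) j (decide (j ∈ insert a S)) =
        ∏ i ∈ I, ∏ j ∈ I with i < j, G i (decide (i ∈ S)) j (decide (j ∈ S)) :=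
      Finset.prod_congr rfl fun i hi => Finset.prod_congr rfl fun j hj => by
        rw [hmem i hi, hmem j (Finset.mem_filter.1 hj).1]
    rw [e1, e2, e3]
    simp only [Finset.mem_insert_self, decide_true]
    ring

theorem signSum_congr {G : ι → Bool → ι → Bool → K} {I : Finset ι} {A B : ι → Bool → K}
    (h : ∀ i ∈ I, ∀ δ, A i δ = B i δ) : signSum I A G = signSum I B G := by
  unfold signSum
  refine Finset.sum_congr rfl fun S _ => ?_
  rw [Finset.prod_congr rfl fun i hi => h i hi _]

theorem signSum_mul {G : ι → Bool → ι → Bool → K} {I : Finset ι} (c : ι → K)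
    (A : ι → Bool → K) :
    signSum I (fun i δ => c i * A i δ) G = (∏ i ∈ I, c i) * signSum I A G := by
  unfold signSum
  rw [Finset.mul_sum]
  refine Finset.sum_congr rfl fun S _ => ?_
  rw [Finset.prod_mul_distrib, mul_assoc]

theorem signSum_eq_mul {G : ι → Bool → ι → Bool → K} {I : Finset ι} (c : ι → K)
    {A B : ι → Bool → K} (h : ∀ i ∈ I, ∀ δ, A i δ = c i * B i δ) :
    signSum I A G = (∏ i ∈ I, c i) * signSum I B G := by
  rw [signSum_congr h, signSum_mul]

@[simp] theorem signSum_empty (A : ι → Bool → K) (G : ι → Bool → ι → Bool → K) :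
    signSum ∅ A G = 1 := by
  simp [signSum]

end signSum

/-! ### Polynomial functions of bounded degree -/

/-- `f` is given by a polynomial of degree at most `d`. -/
def IsPolyFun {K : Type*} [Field K] (d : ℕ) (f : K → K) : Prop :=
  ∃ P : Polynomial K, P.natDegree ≤ d ∧ ∀ z, P.eval z = f z

namespace IsPolyFun

variable {K : Type*} [Field K]

theorem const (c : K) : IsPolyFun 0 (fun _ => c) :=
  ⟨Polynomial.C c, by simp, by simp⟩

theorem linear (a b : K) : IsPolyFun 1 (fun z => a + b * z) :=
  ⟨Polynomial.C a + Polynomial.C b * Polynomial.X, by compute_degree, by simp⟩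

theorem mono {d e : ℕ} {f : K → K} (hf : IsPolyFun d f) (h : d ≤ e) : IsPolyFun e f := by
  obtain ⟨P, hP, hf⟩ := hf
  exact ⟨P, hP.trans h, hf⟩

theorem add {d : ℕ} {f g : K → K} (hf : IsPolyFun d f) (hg : IsPolyFun d g) :
    IsPolyFun d (fun z => f z + g z) := by
  obtain ⟨P, hP, hf⟩ := hf
  obtain ⟨Q, hQ, hg⟩ := hg
  exact ⟨P + Q, (Polynomial.natDegree_add_le _ _).trans (max_le hP hQ), by simp [hf, hg]⟩

theorem mul {d e : ℕ} {f g : K → K} (hf : IsPolyFun d f) (hg : IsPolyFun e g) :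
    IsPolyFun (d + e) (fun z => f z * g z) := by
  obtain ⟨P, hP, hf⟩ := hf
  obtain ⟨Q, hQ, hg⟩ := hg
  exact ⟨P * Q, Polynomial.natDegree_mul_le.trans (add_le_add hP hQ), by simp [hf, hg]⟩

theorem const_mul {d : ℕ} {f : K → K} (c : K) (hf : IsPolyFun d f) :
    IsPolyFun d (fun z => c * f z) := by
  simpa using (const c).mul hf

theorem sub {d : ℕ} {f g : K → K} (hf : IsPolyFun d f) (hg : IsPolyFun d g) :
    IsPolyFun d (fun z => f z - g z) := by
  simpa [sub_eq_add_neg] using hf.add (hg.const_mul (-1))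

theorem sum {α : Type*} {s : Finset α} {d : ℕ} {f : α → K → K}
    (hf : ∀ i ∈ s, IsPolyFun d (f i)) : IsPolyFun d (fun z => ∑ i ∈ s, f i z) := by
  classical
  induction s using Finset.induction_on with
  | empty => simpa using (const (0 : K)).mono (Nat.zero_le d)
  | insert a s ha ih =>
    simp only [Finset.sum_insert ha]
    exact (hf a (by simp)).add (ih fun i hi => hf i (by simp [hi]))

theorem prod {α : Type*} {s : Finset α} {d : ℕ} {f : α → K → K}
    (hf : ∀ i ∈ s, IsPolyFun d (f i)) : IsPolyFun (d * s.card) (fun z => ∏ i ∈ s, f i z) := by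
  classical
  induction s using Finset.induction_on with
  | empty => simpa using const (1 : K)
  | insert a s ha ih =>
    simp only [Finset.prod_insert ha, Finset.card_insert_of_notMem ha]
    exact ((hf a (by simp)).mul (ih fun i hi => hf i (by simp [hi]))).mono (by ring_nf; rfl)

/-- The variable enters only the one-point weights, so each element of `I` adds at most `d` to the
degree. -/
theorem signSum {ι : Type*} [LinearOrder ι] {I : Finset ι} {d : ℕ} {A : K → ι → Bool → K}
    (G : ι → Bool → ι → Bool → K) (hA : ∀ i ∈ I, ∀ δ, IsPolyFun d (fun z => A z i δ)) :
    IsPolyFun (d * I.card) (fun z => signSum I (A z) G) := by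
  unfold _root_.signSum
  refine sum fun S _ => ?_
  simpa using (prod fun i hi => hA i hi (decide (i ∈ S))).mul (const _)

theorem eq_zero {d : ℕ} {f : K → K} (hf : IsPolyFun d f) {s : Finset K} (hs : d < s.card)
    (h : ∀ z ∈ s, f z = 0) (z : K) : f z = 0 := by
  obtain ⟨P, hP, hf⟩ := hf
  have : P = 0 := Polynomial.eq_zero_of_natDegree_lt_card_of_eval_eq_zero' P s
    (fun z hz => by rw [hf, h z hz]) (hP.trans_lt hs)
  rw [← hf, this, Polynomial.eval_zero]

end IsPolyFun

/-! ### Weights and genericity for the duality with multiplicities one -/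

section multiplicityOne

variable {K ι κ : Type*} [Field K]

/-- `x` or `x⁻¹`, according to a sign. -/
def signPow (x : K) (ε : Bool) : K := bif ε then x⁻¹ else x

/-- The two-point weight `(1 - q p) / (1 - p)`. -/
def pairKernel (q p : K) : K := (1 - q * p) / (1 - p)

/-- The product `w ^ ε * w' ^ δ`, where `w ^ 2 = q u ^ 2` and `w' ^ 2 = q v ^ 2`. -/
def dualArg (q u v : K) : Bool → Bool → K
  | false, false => q * (u * v)
  | false, true => u / v
  | true, false => v / u
  | true, true => (q * (u * v))⁻¹

/-- The two-point weight for the variables `x`. -/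
def kernX (q : K) (x : ι → K) (i : ι) (ε : Bool) (j : ι) (δ : Bool) : K :=
  pairKernel q (signPow (x i) ε * signPow (x j) δ)

/-- The two-point weight for the variables `z`. -/
def kernZ (q : K) (z : κ → K) (a : κ) (ε : Bool) (b : κ) (δ : Bool) : K :=
  pairKernel q (dualArg q (z a) (z b) ε δ)

/-- The one-point weight for the variables `x`. -/
def weightX (q : K) (x : ι → K) (z : κ → K) (T : Finset κ) (i : ι) (ε : Bool) : K :=
  (1 - q * signPow (x i) ε ^ 2) / (1 - signPow (x i) ε ^ 2) *
    ∏ l ∈ T, (1 - q * z l * signPow (x i) (!ε)) / (1 - z l * signPow (x i) (!ε))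

/-- The factor by which a variable `x` contributes to the weight of a variable `z`. -/
def crossFactor (q x z : K) : K :=
  (1 - q * (x * z)) * (1 - q * (z / x)) / (q * ((1 - x * z) * (1 - z / x)))

/-- The one-point weight for the variables `z`. -/
def weightZ (q : K) (x : ι → K) (z : κ → K) (I : Finset ι) (a : κ) (ε : Bool) : K :=
  bif ε then ∏ i ∈ I, crossFactor q (x i) (z a) else 1

/-- The factor relating the two sums. -/
def dualityConst (q : K) (n s : ℕ) : K :=
  q ^ ((n : ℤ) * (s : ℤ) - (s.choose 2 : ℤ)) * qPochInt (-q) q ((n : ℤ) - (s : ℤ))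

/-- The parameters avoid all the coincidences that matter for the interpolation argument. -/
structure Generic (q : K) (x : ι → K) (z : κ → K) : Prop where
  q_ne : q ≠ 0
  q_pow : ∀ j : ℕ, q ^ j ≠ -1
  q_one : q ≠ 1
  x_ne : ∀ i, x i ≠ 0
  z_ne : ∀ a, z a ≠ 0
  xx_mul : ∀ i j, x i * x j ≠ 1
  xx_ne : ∀ i j, i ≠ j → x i ≠ x j
  qxx_mul : ∀ i j, q * (x i * x j) ≠ 1
  qxx_ne : ∀ i j, q * x i ≠ x j
  zz_ne : ∀ a b, a ≠ b → z a ≠ z b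
  qzz_mul : ∀ a b, q * (z a * z b) ≠ 1
  zx_mul : ∀ a i, z a * x i ≠ 1
  zx_ne : ∀ a i, z a ≠ x i
  qzx_mul : ∀ a i, q * (z a * x i) ≠ 1
  qzx_ne : ∀ a i, q * z a ≠ x i

theorem Generic.mul_sub {q : K} {x : ι → K} {z : κ → K} (g : Generic q x z) (a : κ) (i : ι) :
    1 - z a * x i ≠ 0 :=
  sub_ne_zero.2 (g.zx_mul a i).symm

theorem Generic.div_sub {q : K} {x : ι → K} {z : κ → K} (g : Generic q x z) (a : κ) (i : ι) :
    1 - z a / x i ≠ 0 :=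
  sub_ne_zero.2 fun h => g.zx_ne a i ((div_eq_one_iff_eq (g.x_ne i)).1 h.symm)

theorem signPow_ne {x : K} (hx : x ≠ 0) (ε : Bool) : signPow x ε ≠ 0 := by
  cases ε <;> simpa [signPow] using hx

theorem signPow_not (x : K) (ε : Bool) : signPow x (!ε) = (signPow x ε)⁻¹ := by
  cases ε <;> simp [signPow]

theorem signPow_symm {α : Type*} (f : K → K → α) (hf : ∀ u v, f u v = f v u) (x : K) (ε : Bool) :
    f (signPow x ε) (signPow x ε)⁻¹ = f x x⁻¹ := by
  cases ε
  · rfl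
  · simp [signPow, hf x⁻¹ x]

theorem Generic.signPow_mul {q : K} {x : ι → K} {z : κ → K} (g : Generic q x z) {i j : ι}
    (h : i ≠ j) (ε δ : Bool) : signPow (x i) ε * signPow (x j) δ ≠ 1 := by
  have h1 := g.xx_mul i j
  have h2 := g.xx_ne i j h
  have h3 := g.x_ne i
  have h4 := g.x_ne j
  cases ε <;> cases δ <;> simp only [signPow, cond_true, cond_false]
  · exact h1
  · rwa [ne_eq, mul_inv_eq_one₀ h4]
  · rwa [ne_eq, inv_mul_eq_one₀ h3]
  · rw [← mul_inv]
    exact fun h => h1 (inv_eq_one.1 h)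

theorem Generic.ne_signPow {q : K} {x : ι → K} {z : κ → K} (g : Generic q x z) (a : κ) (i : ι)
    (ε : Bool) : z a ≠ signPow (x i) ε := by
  cases ε
  · exact g.zx_ne a i
  · exact fun h => g.zx_mul a i (by rw [h]; exact inv_mul_cancel₀ (g.x_ne i))

/-- Invariance under x ↦ x⁻¹, which lets the zeros x_i and x_i⁻¹ be treated together. -/
theorem crossFactor_signPow (q x z : K) (ε : Bool) :
    crossFactor q (signPow x ε) z = crossFactor q x z := by
  have := signPow_symm (fun u v => (1 - q * (u * z)) * (1 - q * (z * v)) /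
    (q * ((1 - u * z) * (1 - z * v)))) (fun u v => by ring_nf) x ε
  simpa only [crossFactor, div_eq_mul_inv] using this

theorem dualArg_comm (q u v : K) (ε δ : Bool) : dualArg q u v ε δ = dualArg q v u δ ε := by
  cases ε <;> cases δ <;> simp [dualArg, mul_comm]

theorem kernX_symm (q : K) (x : ι → K) (i : ι) (ε : Bool) (j : ι) (δ : Bool) :
    kernX q x i ε j δ = kernX q x j δ i ε := by
  simp only [kernX, mul_comm]

theorem kernZ_symm (q : K) (z : κ → K) (i : κ) (ε : Bool) (j : κ) (δ : Bool) :
    kernZ q z i ε j δ = kernZ q z j δ i ε := by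
  simp only [kernZ, dualArg_comm q (z i)]

/-- Relates the two products over `I` in `clearedDiff`: their quotient is the one-point weight of a
negative Z = `z s`. -/
theorem prod_zeros {q : K} {x : ι → K} {z : κ → K} (g : Generic q x z) (I : Finset ι) (s : κ) :
    ∏ i ∈ I, (1 - q * z s * x i) * (1 - q * z s / x i) / q =
      (∏ i ∈ I, (1 - z s * x i) * (1 - z s / x i)) * ∏ i ∈ I, crossFactor q (x i) (z s) := by
  rw [← Finset.prod_mul_distrib]
  refine Finset.prod_congr rfl fun i _ => ?_
  have h1 := g.mul_sub s i
  have h2 := g.div_sub s i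
  have h3 := g.q_ne
  rw [mul_comm (z s)] at h1 ⊢
  rw [crossFactor, mul_div_assoc', div_eq_div_iff h3 (mul_ne_zero h3 (mul_ne_zero h1 h2))]
  ring

theorem weightZ_insert [LinearOrder ι] (q : K) (x : ι → K) (z : κ → K) {I : Finset ι} {i : ι} (hi : i ∉ I) (a : κ)
    (δ : Bool) : weightZ q x z (insert i I) a δ =
      (bif δ then crossFactor q (x i) (z a) else 1) * weightZ q x z I a δ := by
  cases δ <;> simp [weightZ, Finset.prod_insert hi]

/-! ### The two sums, the cleared difference and its zeros -/

variable [LinearOrder ι] [LinearOrder κ]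

/-- The sum over signs of the variables `x`. -/
def sumX (q : K) (x : ι → K) (z : κ → K) (I : Finset ι) (T : Finset κ) : K :=
  signSum I (weightX q x z T) (kernX q x)

/-- The sum over signs of the variables `z`. -/
def sumZ (q : K) (x : ι → K) (z : κ → K) (I : Finset ι) (T : Finset κ) : K :=
  signSum T (weightZ q x z I) (kernZ q z)

/-- The part of the cleared difference that comes from a variable `x`. -/
def clearX (q x Z : K) (δ : Bool) : K :=
  (1 - q * Z * signPow x (!δ)) * (1 - Z * signPow x δ)

/-- The part of the cleared difference that comes from a pair of variables `z`. -/
def clearZ (q u Z : K) : Bool → Bool → K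
  | false, false => (1 - q ^ 2 * Z * u) * (1 - Z / u)
  | false, true => (1 - q * Z / u) * (1 - q * Z * u)
  | true, false => (q - Z / u) * (1 - q * Z * u)
  | true, true => q * (1 - Z * u) * (1 - Z / u)

/-- The difference of the two sides of the identity, as a function of one additional variable `Z`
of the second kind, multiplied by all denominators which involve `Z`. -/
def clearedDiff (q : K) (x : ι → K) (z : κ → K) (I : Finset ι) (T : Finset κ) (C Z : K) : K :=
  (∏ a ∈ T, (1 - Z / z a) * (1 - q * Z * z a)) *
      signSum I (fun i δ => weightX q x z T i δ * clearX q (x i) Z δ) (kernX q x) -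
    C * ((∏ i ∈ I, (1 - Z * x i) * (1 - Z / x i)) *
        signSum T (fun a δ => weightZ q x z I a δ * clearZ q (z a) Z false δ) (kernZ q z) +
      (∏ i ∈ I, (1 - q * Z * x i) * (1 - q * Z / x i) / q) *
        signSum T (fun a δ => weightZ q x z I a δ * clearZ q (z a) Z true δ) (kernZ q z))

theorem isPolyFun_quadratic (a b c d : K) : IsPolyFun 2 (fun Z => (a + b * Z) * (c + d * Z)) :=
  (IsPolyFun.linear a b).mul (IsPolyFun.linear c d)

theorem isPolyFun_clearX (q x : K) (δ : Bool) : IsPolyFun 2 (fun Z => clearX q x Z δ) := by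
  convert isPolyFun_quadratic 1 (-(q * signPow x (!δ))) 1 (-signPow x δ) using 2
  unfold clearX
  ring

theorem isPolyFun_clearZ (q u : K) (ε δ : Bool) : IsPolyFun 2 (fun Z => clearZ q u Z ε δ) := by
  cases ε <;> cases δ
  · convert isPolyFun_quadratic 1 (-(q ^ 2 * u)) 1 (-u⁻¹) using 2
    simp only [clearZ]; ring
  · convert isPolyFun_quadratic 1 (-(q * u⁻¹)) 1 (-(q * u)) using 2
    simp only [clearZ]; ring
  · convert isPolyFun_quadratic q (-u⁻¹) 1 (-(q * u)) using 2
    simp only [clearZ]; ring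
  · convert isPolyFun_quadratic q (-(q * u)) 1 (-u⁻¹) using 2
    simp only [clearZ]; ring

theorem isPolyFun_clearedDiff (q : K) (x : ι → K) (z : κ → K) (I : Finset ι) (T : Finset κ)
    (C : K) : IsPolyFun (2 * I.card + 2 * T.card) (clearedDiff q x z I T C) := by
  unfold clearedDiff
  have hZ : ∀ ε, IsPolyFun (2 * T.card) (fun Z =>
      signSum T (fun a δ => weightZ q x z I a δ * clearZ q (z a) Z ε δ) (kernZ q z)) := fun ε =>
    IsPolyFun.signSum _ fun a _ δ => (isPolyFun_clearZ q (z a) ε δ).const_mul _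
  have hX : IsPolyFun (2 * I.card) (fun Z =>
      signSum I (fun i δ => weightX q x z T i δ * clearX q (x i) Z δ) (kernX q x)) :=
    IsPolyFun.signSum _ fun a _ δ => (isPolyFun_clearX q (x a) δ).const_mul _
  have h1 : IsPolyFun (2 * T.card) (fun Z => ∏ a ∈ T, (1 - Z / z a) * (1 - q * Z * z a)) := by
    refine IsPolyFun.prod fun a _ => ?_
    convert isPolyFun_quadratic 1 (-(z a)⁻¹) 1 (-(q * z a)) using 2
    ring
  have h2 : IsPolyFun (2 * I.card) (fun Z => ∏ i ∈ I, (1 - Z * x i) * (1 - Z / x i)) := by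
    refine IsPolyFun.prod fun a _ => ?_
    convert isPolyFun_quadratic 1 (-x a) 1 (-(x a)⁻¹) using 2
    ring
  have h3 : IsPolyFun (2 * I.card)
      (fun Z => ∏ i ∈ I, (1 - q * Z * x i) * (1 - q * Z / x i) / q) := by
    refine IsPolyFun.prod fun a _ => ?_
    convert isPolyFun_quadratic q⁻¹ (-(q * x a) * q⁻¹) 1 (-(q * (x a)⁻¹)) using 2
    ring
  exact ((h1.mul hX).mono (by omega)).sub (((h2.mul (hZ false)).add (h3.mul (hZ true))).const_mul C)

/-- Explains `clearZ`: one common factor clears the kernel for all four sign patterns. Being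
polynomial in Z, `clearZ` keeps its meaning at the poles excluded here. -/
theorem clearZ_eq {q u Z : K} (hq : q ≠ 0) (hu : u ≠ 0) (hZ : Z ≠ 0) (h1 : Z ≠ u)
    (h2 : q * (Z * u) ≠ 1) (ε δ : Bool) :
    clearZ q u Z ε δ = (1 - Z / u) * (1 - q * Z * u) * pairKernel q (dualArg q Z u ε δ) := by
  have e1 : u - Z ≠ 0 := sub_ne_zero.2 h1.symm
  have e2 : 1 - q * Z * u ≠ 0 := sub_ne_zero.2 fun h => h2 (by rw [h]; ring)
  have e3 : Z - u ≠ 0 := sub_ne_zero.2 h1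
  have e4 : q * Z * u - 1 ≠ 0 := sub_ne_zero.2 fun h => h2 (by rw [← h]; ring)
  cases ε <;> cases δ <;> simp only [clearZ, pairKernel, dualArg]
  · rw [mul_div_assoc', eq_div_iff (by convert e2 using 1; ring)]; ring
  · rw [mul_div_assoc', eq_div_iff (by rw [one_sub_div hu]; exact div_ne_zero e1 hu)]; ring
  · rw [mul_div_assoc', eq_div_iff (by rw [one_sub_div hZ]; exact div_ne_zero e3 hZ)]
    field_simp; ring
  · have : 1 - (q * (Z * u))⁻¹ = (q * Z * u - 1) / (q * Z * u) := by field_simp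
    rw [this]
    field_simp
    ring

/-- The two terms multiplied by `C` are the two signs of the new variable in `signSum_insert`; all
cleared denominators come out as common factors. -/
theorem clearedDiff_apply {q : K} {x : ι → K} {z : κ → K} (g : Generic q x z) (I : Finset ι)
    {T : Finset κ} {s : κ} (hs : s ∉ T) (C : K) :
    clearedDiff q x z I T C (z s) =
      (∏ a ∈ T, (1 - z s / z a) * (1 - q * z s * z a)) *
      (∏ i ∈ I, (1 - z s * x i) * (1 - z s / x i)) *
      (sumX q x z I (insert s T) - C * sumZ q x z I (insert s T)) := by
  have hL : signSum I (fun i δ => weightX q x z T i δ * clearX q (x i) (z s) δ) (kernX q x) =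
      (∏ i ∈ I, (1 - z s * x i) * (1 - z s / x i)) * sumX q x z I (insert s T) := by
    refine signSum_eq_mul _ fun i _ δ => ?_
    rw [weightX, weightX, Finset.prod_insert hs]
    have aux : ∀ {f P N D E : K}, D ≠ 0 → f * P * (N * E) = D * E * (f * (N / D * P)) := by
      intro f P N D E hD
      field_simp
    have e : (1 - z s * x i) * (1 - z s / x i) =
        (1 - z s * signPow (x i) (!δ)) * (1 - z s * signPow (x i) δ) := by
      cases δ <;> simp [signPow, div_eq_mul_inv, mul_comm]
    rw [e, clearX]
    exact aux (sub_ne_zero.2 fun h => g.ne_signPow s i δ (by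
      rw [← Bool.not_not δ, signPow_not]
      exact eq_inv_of_mul_eq_one_left h.symm))
  have hR : ∀ ε, (∏ a ∈ T, (1 - z s / z a) * (1 - q * z s * z a)) *
      signSum T (fun a δ => weightZ q x z I a δ * kernZ q z s ε a δ) (kernZ q z) =
      signSum T (fun a δ => weightZ q x z I a δ * clearZ q (z a) (z s) ε δ) (kernZ q z) := by
    intro ε
    refine (signSum_eq_mul _ fun a ha δ => ?_).symm
    have hne : s ≠ a := fun h => hs (h ▸ ha)
    rw [clearZ_eq g.q_ne (g.z_ne a) (g.z_ne s) (g.zz_ne _ _ hne) (g.qzz_mul s a), kernZ]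
    ring
  rw [clearedDiff, hL, ← hR, ← hR, prod_zeros g]
  simp only [sumZ]
  rw [signSum_insert (kernZ_symm q z) hs]
  simp only [weightZ, cond_true, cond_false]
  ring

/-- At Z = 0 the weights of Z become constants: 1 in total for the positive sign and q^(|T| - |I|)
for the negative one. -/
theorem clearedDiff_zero (q : K) (x : ι → K) (z : κ → K) (I : Finset ι) (T : Finset κ) (C : K) :
    clearedDiff q x z I T C 0 =
      sumX q x z I T - C * ((1 + q ^ T.card * (q⁻¹) ^ I.card) * sumZ q x z I T) := by
  have hL : signSum I (fun i δ => weightX q x z T i δ * clearX q (x i) 0 δ) (kernX q x) =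
      sumX q x z I T := signSum_congr fun i _ δ => by simp [clearX]
  have h0 : signSum T (fun a δ => weightZ q x z I a δ * clearZ q (z a) 0 false δ) (kernZ q z) =
      sumZ q x z I T := signSum_congr fun i _ δ => by cases δ <;> simp [clearZ]
  have h1 : signSum T (fun a δ => weightZ q x z I a δ * clearZ q (z a) 0 true δ) (kernZ q z) =
      q ^ T.card * sumZ q x z I T := by
    rw [← Finset.prod_const]
    exact signSum_eq_mul _ fun i _ δ => by cases δ <;> simp [clearZ, mul_comm]
  rw [clearedDiff, hL, h0, h1]
  simp only [zero_div, mul_zero, zero_mul, sub_zero, mul_one, one_mul, Finset.prod_const, one_div,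
    one_pow]
  ring

theorem signSum_insert_not {G : ι → Bool → ι → Bool → K}
    (hG : ∀ i ε j δ, G i ε j δ = G j δ i ε) {a : ι} {I : Finset ι} (ha : a ∉ I)
    (A : ι → Bool → K) (ε : Bool) :
    signSum (insert a I) A G =
      A a ε * signSum I (fun i δ => A i δ * G a ε i δ) G +
      A a (!ε) * signSum I (fun i δ => A i δ * G a (!ε) i δ) G := by
  rw [signSum_insert hG ha]
  cases ε
  · rfl
  · exact add_comm _ _

/-- At Z = x_i^(±1) the factor `clearX` removes one sign of x_i, and the term with Z positive
vanishes. The surviving weights involving x_i or Z reduce to factors common to both sides, leaving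
the identity without x_i. -/
theorem clearedDiff_signPow {q : K} {x : ι → K} {z : κ → K} (g : Generic q x z) {I : Finset ι}
    {i : ι} (hi : i ∉ I) (T : Finset κ) (C : K) (ε : Bool)
    (h : sumX q x z I T = C * (q⁻¹) ^ (I.card + 1) * sumZ q x z I T) :
    clearedDiff q x z (insert i I) T C (signPow (x i) ε) = 0 := by
  have hq := g.q_ne
  obtain ⟨y, hy⟩ : ∃ y, signPow (x i) ε = y := ⟨_, rfl⟩
  have hy0 : y ≠ 0 := hy ▸ signPow_ne (g.x_ne i) ε
  have hy2 : 1 - y ^ 2 ≠ 0 := by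
    have h1 := g.xx_mul i i
    rw [sub_ne_zero, ← hy]
    cases ε <;> simp only [signPow, cond_true, cond_false]
    · rw [pow_two]; exact h1.symm
    · rw [pow_two, ← mul_inv]; exact fun h => h1 (inv_eq_one.1 h.symm)
  have hzy : ∀ a, 1 - z a / y ≠ 0 := fun a => sub_ne_zero.2 fun h =>
    g.ne_signPow a i ε (hy ▸ (div_eq_one_iff_eq hy0).1 h.symm)
  have hyz : ∀ a, 1 - y * z a ≠ 0 := fun a => sub_ne_zero.2 fun h =>
    g.ne_signPow a i (!ε) (by rw [signPow_not, hy]; exact eq_inv_of_mul_eq_one_right h.symm)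
  have hyx : ∀ f : K → K → K, (∀ u v, f u v = f v u) → f (x i) (x i)⁻¹ = f y y⁻¹ := fun f hf => by
    rw [← hy, signPow_symm f hf]
  have hS : signSum I (fun j δ => weightX q x z T j δ * clearX q (x j) y δ * kernX q x i ε j δ)
      (kernX q x) = (∏ j ∈ I, (1 - q * y * x j) * (1 - q * y / x j)) * sumX q x z I T := by
    refine signSum_eq_mul _ fun j hj δ => ?_
    have hij : i ≠ j := fun h => hi (h ▸ hj)
    have hne : 1 - y * signPow (x j) δ ≠ 0 := sub_ne_zero.2 (hy ▸ (g.signPow_mul hij ε δ).symm)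
    have : clearX q (x j) y δ * kernX q x i ε j δ = (1 - q * y * x j) * (1 - q * y / x j) := by
      rw [clearX, kernX, hy, pairKernel, mul_div_assoc', div_eq_iff hne]
      cases δ <;> simp only [signPow, cond_true, cond_false, Bool.not_true, Bool.not_false] <;> ring
    rw [mul_assoc, this, mul_comm]
  have hL : (∏ a ∈ T, (1 - y / z a) * (1 - q * y * z a)) *
      signSum (insert i I) (fun j δ => weightX q x z T j δ * clearX q (x j) y δ) (kernX q x) =
      (1 - q) * (1 - q * y ^ 2) * (∏ a ∈ T, (q - y / z a) * (1 - q * y * z a)) *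
      (∏ j ∈ I, (1 - q * y * x j) * (1 - q * y / x j)) * sumX q x z I T := by
    have h0 : clearX q (x i) y (!ε) = 0 := by
      rw [clearX, Bool.not_not, signPow_not, hy, mul_inv_cancel₀ hy0]; ring
    have h1 : clearX q (x i) y ε = (1 - q) * (1 - y ^ 2) := by
      rw [clearX, signPow_not, hy, mul_assoc, mul_inv_cancel₀ hy0]; ring
    have h2 : (∏ a ∈ T, (1 - y / z a) * (1 - q * y * z a)) *
        ∏ a ∈ T, (1 - q * z a * y⁻¹) / (1 - z a * y⁻¹) =
        ∏ a ∈ T, (q - y / z a) * (1 - q * y * z a) := by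
      rw [← Finset.prod_mul_distrib]
      refine Finset.prod_congr rfl fun a _ => ?_
      have h3 := hzy a
      have h4 := g.z_ne a
      rw [div_eq_mul_inv] at h3
      rw [mul_div_assoc', div_eq_iff h3]
      field_simp
      ring
    rw [signSum_insert_not (kernX_symm q x) hi _ ε, h0, h1, hS, weightX, signPow_not, hy, ← h2]
    have h5 : (1 - q * y ^ 2) / (1 - y ^ 2) * ((1 - q) * (1 - y ^ 2)) =
        (1 - q) * (1 - q * y ^ 2) := by
      field_simp
    linear_combination (∏ a ∈ T, (1 - y / z a) * (1 - q * y * z a)) *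
      (∏ a ∈ T, (1 - q * z a * y⁻¹) / (1 - z a * y⁻¹)) *
      (∏ j ∈ I, (1 - q * y * x j) * (1 - q * y / x j)) * sumX q x z I T * h5
  have hP : ∏ j ∈ insert i I, (1 - y * x j) * (1 - y / x j) = 0 := by
    refine Finset.prod_eq_zero (Finset.mem_insert_self i I) ?_
    have := hyx (fun u v => (1 - y * u) * (1 - y * v)) (fun u v => mul_comm _ _)
    rw [div_eq_mul_inv, this, mul_inv_cancel₀ hy0]
    ring
  have hZ : ∏ j ∈ insert i I, (1 - q * y * x j) * (1 - q * y / x j) / q =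
      (q⁻¹) ^ (I.card + 1) * ((1 - q) * (1 - q * y ^ 2)) *
        ∏ j ∈ I, (1 - q * y * x j) * (1 - q * y / x j) := by
    have := hyx (fun u v => (1 - q * y * u) * (1 - q * y * v)) (fun u v => mul_comm _ _)
    simp only [div_eq_mul_inv] at this ⊢
    rw [Finset.prod_insert hi, this, Finset.prod_mul_distrib (g := fun _ => q⁻¹),
      Finset.prod_const, mul_assoc q y y⁻¹, mul_inv_cancel₀ hy0]
    ring
  have hR : signSum T (fun a δ => weightZ q x z (insert i I) a δ * clearZ q (z a) y true δ)
      (kernZ q z) = (∏ a ∈ T, (q - y / z a) * (1 - q * y * z a)) * sumZ q x z I T := by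
    refine signSum_eq_mul _ fun a _ δ => ?_
    rw [weightZ_insert q x z hi, ← crossFactor_signPow q (x i) (z a) ε, hy]
    cases δ
    · simp only [cond_false, clearZ]; ring
    · have h3 := hzy a
      have h4 := g.z_ne a
      have h5 := hyz a
      have : crossFactor q y (z a) * clearZ q (z a) y true true =
          (q - y / z a) * (1 - q * y * z a) := by
        simp only [crossFactor, clearZ]
        rw [div_mul_eq_mul_div, div_eq_iff (mul_ne_zero hq (mul_ne_zero h5 h3))]
        field_simp
        ring
      rw [cond_true, ← this]
      ring
  rw [hy, clearedDiff, hL, hP, hZ, hR, h]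
  ring

/-- The same collapse with the roles of the signs of Z exchanged: 1 - q Z x_i = 0 removes the
negative sign of x_i and the term with Z negative. This is the zero beyond the 2|I| + 2|T| symmetric
ones. -/
theorem clearedDiff_extra {q : K} {x : ι → K} {z : κ → K} (g : Generic q x z) {I : Finset ι}
    {i : ι} (hi : i ∉ I) (T : Finset κ) (C : K)
    (h : sumX q x z I T = C * (q⁻¹) ^ (I.card + 1) * sumZ q x z I T) :
    clearedDiff q x z (insert i I) T C (q * x i)⁻¹ = 0 := by
  have hq := g.q_ne
  have hx := g.x_ne i
  have hy2 : 1 - x i ^ 2 ≠ 0 := by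
    rw [pow_two]
    exact sub_ne_zero.2 (g.xx_mul i i).symm
  obtain ⟨Y, hY⟩ : ∃ Y, (q * x i)⁻¹ = Y := ⟨_, rfl⟩
  have hYx : q * Y * x i = 1 := by rw [← hY]; field_simp
  have hS : signSum I (fun j δ => weightX q x z T j δ * clearX q (x j) Y δ * kernX q x i false j δ)
      (kernX q x) =
      (∏ j ∈ I, q * ((1 - Y * x j) * (1 - Y / x j))) * sumX q x z I T := by
    refine signSum_eq_mul _ fun j hj δ => ?_
    have hne := g.signPow_mul (fun h => hi (h ▸ hj) : i ≠ j) false δ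
    have hne' : 1 - x i * signPow (x j) δ ≠ 0 := sub_ne_zero.2 hne.symm
    have hxj := g.x_ne j
    have : clearX q (x j) Y δ * kernX q x i false j δ = q * ((1 - Y * x j) * (1 - Y / x j)) := by
      have e : signPow (x i) false = x i := rfl
      rw [clearX, kernX, e, pairKernel, mul_div_assoc', div_eq_iff hne', ← hY]
      cases δ <;> simp only [signPow, cond_true, cond_false, Bool.not_true, Bool.not_false] <;>
        field_simp <;> ring
    rw [mul_assoc, this, mul_comm]
  have hL : (∏ a ∈ T, (1 - Y / z a) * (1 - q * Y * z a)) *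
      signSum (insert i I) (fun j δ => weightX q x z T j δ * clearX q (x j) Y δ) (kernX q x) =
      q ^ (I.card + 1) * (∏ j ∈ insert i I, (1 - Y * x j) * (1 - Y / x j)) *
      (∏ a ∈ T, (1 - q * z a / x i) * (1 - Y / z a)) * sumX q x z I T := by
    have h0 : clearX q (x i) Y true = 0 := by
      simp only [clearX, signPow, Bool.not_true, cond_false, hYx]; ring
    have h1 : (1 - q * x i ^ 2) / (1 - x i ^ 2) * clearX q (x i) Y false =
        q * ((1 - Y * x i) * (1 - Y / x i)) := by
      rw [div_mul_eq_mul_div, div_eq_iff hy2, ← hY]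
      simp only [clearX, signPow, Bool.not_false, cond_false, cond_true]
      field_simp
      ring
    have h2 : (∏ a ∈ T, (1 - Y / z a) * (1 - q * Y * z a)) *
        ∏ a ∈ T, (1 - q * z a * (x i)⁻¹) / (1 - z a * (x i)⁻¹) =
        ∏ a ∈ T, (1 - q * z a / x i) * (1 - Y / z a) := by
      rw [← Finset.prod_mul_distrib]
      refine Finset.prod_congr rfl fun a _ => ?_
      have h3 := g.div_sub a i
      have h4 := g.z_ne a
      rw [div_eq_mul_inv] at h3
      rw [mul_div_assoc', div_eq_iff h3, ← hY]
      field_simp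
    have h3 : ∏ j ∈ I, q * ((1 - Y * x j) * (1 - Y / x j)) =
        q ^ I.card * ∏ j ∈ I, (1 - Y * x j) * (1 - Y / x j) := by
      rw [Finset.prod_mul_distrib, Finset.prod_const]
    have e : signPow (x i) true = (x i)⁻¹ := rfl
    have e' : signPow (x i) false = x i := rfl
    rw [signSum_insert (kernX_symm q x) hi, h0, hS, weightX, Bool.not_false, e, e', h3, ← h2,
      Finset.prod_insert hi]
    linear_combination (∏ a ∈ T, (1 - Y / z a) * (1 - q * Y * z a)) *
        (∏ a ∈ T, (1 - q * z a * (x i)⁻¹) / (1 - z a * (x i)⁻¹)) * (q ^ I.card *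
        ∏ j ∈ I, (1 - Y * x j) * (1 - Y / x j)) * sumX q x z I T * h1
  have hZ : ∏ j ∈ insert i I, (1 - q * Y * x j) * (1 - q * Y / x j) / q = 0 := by
    refine Finset.prod_eq_zero (Finset.mem_insert_self i I) ?_
    rw [hYx]
    ring
  have hR : signSum T (fun a δ => weightZ q x z (insert i I) a δ * clearZ q (z a) Y false δ)
      (kernZ q z) = (∏ a ∈ T, (1 - q * z a / x i) * (1 - Y / z a)) * sumZ q x z I T := by
    refine signSum_eq_mul _ fun a _ δ => ?_
    rw [weightZ_insert q x z hi]
    cases δ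
    · simp only [cond_false, clearZ]
      rw [← hY]
      field_simp
    · have h3 := g.div_sub a i
      have h4 := g.z_ne a
      have h5 := g.mul_sub a i
      rw [mul_comm] at h5
      have : crossFactor q (x i) (z a) * clearZ q (z a) Y false true =
          (1 - q * z a / x i) * (1 - Y / z a) := by
        simp only [crossFactor, clearZ]
        rw [div_mul_eq_mul_div, div_eq_iff (mul_ne_zero hq (mul_ne_zero h5 h3)), ← hY]
        field_simp
        ring
      rw [cond_true, ← this]
      ring
  rw [hY, clearedDiff, hL, hZ, hR, h]
  have : q ^ (I.card + 1) * (q⁻¹) ^ (I.card + 1) = 1 := by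
    rw [← mul_pow, mul_inv_cancel₀ hq, one_pow]
  linear_combination C * (∏ j ∈ insert i I, (1 - Y * x j) * (1 - Y / x j)) *
      (∏ a ∈ T, (1 - q * z a / x i) * (1 - Y / z a)) * sumZ q x z I T * this

/-- When Z meets z_a, equal signs of the two contribute nothing, and the two opposite assignments
cancel, since exchanging them only changes the sign of `clearZ`. No induction hypothesis is
involved. -/
theorem clearedDiff_pole {q : K} {x : ι → K} {z : κ → K} (g : Generic q x z) (I : Finset ι)
    {T : Finset κ} {a : κ} (ha : a ∉ T) (C : K) :
    clearedDiff q x z I (insert a T) C (z a) = 0 := by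
  have hq := g.q_ne
  have hz := g.z_ne a
  have h0 : ∏ b ∈ insert a T, (1 - z a / z b) * (1 - q * z a * z b) = 0 := by
    refine Finset.prod_eq_zero (Finset.mem_insert_self a T) ?_
    rw [div_self hz]
    ring
  have hff : clearZ q (z a) (z a) false false = 0 := by
    simp only [clearZ, div_self hz]; ring
  have htt : clearZ q (z a) (z a) true true = 0 := by
    simp only [clearZ, div_self hz]; ring
  have hft : clearZ q (z a) (z a) false true = - clearZ q (z a) (z a) true false := by
    simp only [clearZ, div_self hz, mul_div_assoc]; ring
  have hS : signSum T (fun b δ => weightZ q x z I b δ * clearZ q (z b) (z a) false δ *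
        kernZ q z a true b δ) (kernZ q z) =
      signSum T (fun b δ => weightZ q x z I b δ * clearZ q (z b) (z a) true δ *
        kernZ q z a false b δ) (kernZ q z) := by
    refine signSum_congr fun b hb δ => ?_
    have hne : a ≠ b := fun h => ha (h ▸ hb)
    rw [clearZ_eq hq (g.z_ne b) hz (g.zz_ne _ _ hne) (g.qzz_mul a b),
      clearZ_eq hq (g.z_ne b) hz (g.zz_ne _ _ hne) (g.qzz_mul a b), kernZ, kernZ]
    ring
  rw [clearedDiff, h0, signSum_insert (kernZ_symm q z) ha, signSum_insert (kernZ_symm q z) ha,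
    hff, htt, hft, hS, prod_zeros g]
  simp only [weightZ, cond_true, cond_false]
  ring

/-- The reflection z ↦ (q z)⁻¹ inverts q^(1/2) z, that is, it flips the sign in `dualArg`. The
cancellation is that of `clearedDiff_pole` with equal and opposite signs interchanged. -/
theorem clearedDiff_pole_inv {q : K} {x : ι → K} {z : κ → K} (g : Generic q x z) (I : Finset ι)
    {T : Finset κ} {a : κ} (ha : a ∉ T) (C : K) :
    clearedDiff q x z I (insert a T) C (q * z a)⁻¹ = 0 := by
  have hq := g.q_ne
  have hz := g.z_ne a
  obtain ⟨Y, hY⟩ : ∃ Y, (q * z a)⁻¹ = Y := ⟨_, rfl⟩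
  have hY0 : Y ≠ 0 := hY ▸ inv_ne_zero (mul_ne_zero hq hz)
  have hYz : q * Y * z a = 1 := by rw [← hY]; field_simp
  have h0 : ∏ b ∈ insert a T, (1 - Y / z b) * (1 - q * Y * z b) = 0 := by
    refine Finset.prod_eq_zero (Finset.mem_insert_self a T) ?_
    rw [hYz]
    ring
  have hft : clearZ q (z a) Y false true = 0 := by
    simp only [clearZ, hYz]; ring
  have htf : clearZ q (z a) Y true false = 0 := by
    simp only [clearZ, hYz]; ring
  have hff : clearZ q (z a) Y false false = - clearZ q (z a) Y true true := by
    simp only [clearZ]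
    linear_combination (1 - Y / z a) * (-q - 1) * hYz
  have hP : ∏ i ∈ I, (1 - Y * x i) * (1 - Y / x i) =
      (∏ i ∈ I, (1 - q * Y * x i) * (1 - q * Y / x i) / q) *
        ∏ i ∈ I, crossFactor q (x i) (z a) := by
    rw [← Finset.prod_mul_distrib]
    refine Finset.prod_congr rfl fun i _ => ?_
    have h1 := g.mul_sub a i
    have h2 := g.div_sub a i
    have h3 := g.x_ne i
    rw [mul_comm (z a)] at h1
    rw [crossFactor, mul_div_assoc', eq_div_iff (mul_ne_zero hq (mul_ne_zero h1 h2)), ← hY]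
    field_simp
    ring
  have hd : ∀ b ε δ, dualArg q Y (z b) ε δ = dualArg q (z a) (z b) (!ε) δ := by
    intro b ε δ
    have h1 := g.z_ne b
    cases ε <;> cases δ <;> simp only [dualArg, Bool.not_true, Bool.not_false, ← hY] <;>
      field_simp
  have hS : signSum T (fun b δ => weightZ q x z I b δ * clearZ q (z b) Y false δ *
        kernZ q z a false b δ) (kernZ q z) =
      signSum T (fun b δ => weightZ q x z I b δ * clearZ q (z b) Y true δ *
        kernZ q z a true b δ) (kernZ q z) := by
    refine signSum_congr fun b hb δ => ?_
    have hne : a ≠ b := fun h => ha (h ▸ hb)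
    have h1 : Y ≠ z b := fun h => g.qzz_mul a b (by rw [← h, ← hYz]; ring)
    have h2 : q * (Y * z b) ≠ 1 := fun h => g.zz_ne a b hne
      (mul_left_cancel₀ (mul_ne_zero hq hY0) (by rw [hYz, ← h]; ring))
    rw [clearZ_eq hq (g.z_ne b) hY0 h1 h2, clearZ_eq hq (g.z_ne b) hY0 h1 h2, hd, hd, kernZ, kernZ,
      Bool.not_true, Bool.not_false]
    ring
  rw [hY, clearedDiff, h0, signSum_insert (kernZ_symm q z) ha, signSum_insert (kernZ_symm q z) ha,
    hff, hft, htf, hS, hP]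
  simp only [weightZ, cond_true, cond_false]
  ring

end multiplicityOne

/-! ### Recursions of the duality constant -/

/-- The recursion persists at negative indices because q^j ≠ -1 keeps every inverted factor away
from zero. -/
theorem qPochInt_neg_succ {K : Type*} [Field K] {q : K} (hq : q ≠ 0) (h : ∀ j : ℕ, q ^ j ≠ -1)
    (N : ℤ) : qPochInt (-q) q (N + 1) = (1 + q ^ (N + 1)) * qPochInt (-q) q N := by
  obtain N | M := N
  · have e : (Int.ofNat N + 1 : ℤ) = Int.ofNat (N + 1) := rfl
    rw [e]
    simp only [qPochInt, qPoch, Finset.prod_range_succ, Int.ofNat_eq_natCast, zpow_natCast]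
    ring
  · have hM : 1 + q ^ (-(M : ℤ)) ≠ 0 := by
      intro h0
      apply h M
      have h1 : q ^ M * q ^ (-(M : ℤ)) = 1 := by
        rw [← zpow_natCast, ← zpow_add₀ hq]; simp
      linear_combination q ^ M * h0 - h1
    have e1 : (Int.negSucc M + 1 : ℤ) = -(M : ℤ) := by rw [Int.negSucc_eq]; ring
    rw [e1]
    cases M with
    | zero =>
      have h2 : (1 + 1 : K) ≠ 0 := by simpa using hM
      have e2 : (-((0 : ℕ) : ℤ)) = Int.ofNat 0 := rfl
      rw [e2]
      simp [qPochInt, qPoch, hq, h2]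
    | succ M =>
      have e2 : (-((M + 1 : ℕ) : ℤ)) = Int.negSucc M := rfl
      have e3 : -q * q ^ (-(((M + 1 : ℕ) : ℤ) + 1)) = -q ^ (-((M + 1 : ℕ) : ℤ)) := by
        rw [neg_mul, ← zpow_one_add₀ hq]; simp
      have e4 : ∀ i, -q ^ (-((M + 1 : ℕ) : ℤ)) * q ^ (i + 1) =
          -q * q ^ (-((M : ℤ) + 1)) * q ^ i := by
        intro i
        push_cast
        rw [pow_succ]
        ring
      have e5 : qPochInt (-q) q (-((M + 1 : ℕ) : ℤ)) =
        (qPoch (-q * q ^ (-((M : ℤ) + 1))) q (M + 1))⁻¹ := rfl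
      have e6 : qPochInt (-q) q (Int.negSucc (M + 1)) =
        (qPoch (-q * q ^ (-(((M + 1 : ℕ) : ℤ) + 1))) q (M + 1 + 1))⁻¹ := rfl
      rw [e5, e6, e3]
      simp only [qPoch]
      rw [Finset.prod_range_succ' _ (M + 1), pow_zero, mul_one, sub_neg_eq_add, mul_inv,
        mul_comm _ (1 + _)⁻¹, ← mul_assoc, mul_inv_cancel₀ hM, one_mul]
      simp only [e4]

section multiplicityOne

variable {K ι κ : Type*} [Field K]

theorem dualityConst_zero (q : K) : dualityConst q 0 0 = 1 := by
  have : ((0 : ℕ) : ℤ) - ((0 : ℕ) : ℤ) = Int.ofNat 0 := rfl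
  rw [dualityConst, this]
  simp [qPochInt, qPoch]

/-- The step for a collapse that removes one x and Z: the difference n - s is unchanged, so only the
power of q moves. -/
theorem dualityConst_succ_succ {q : K} (hq : q ≠ 0) (n t : ℕ) :
    dualityConst q (n + 1) (t + 1) * (q⁻¹) ^ (n + 1) = dualityConst q n t := by
  have e : ((n + 1 : ℕ) : ℤ) - ((t + 1 : ℕ) : ℤ) = (n : ℤ) - t := by push_cast; ring
  have e1 : (q⁻¹) ^ (n + 1) = q ^ (-((n + 1 : ℕ) : ℤ)) := by
    rw [zpow_neg, zpow_natCast, inv_pow]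
  rw [dualityConst, dualityConst, e, e1, mul_right_comm, ← zpow_add₀ hq, Nat.choose_succ_succ' t 1, Nat.choose_one_right]
  congr 2
  push_cast
  ring

/-- Absorbs the factor that appears in `clearedDiff_zero`. -/
theorem dualityConst_succ {q : K} (hq : q ≠ 0) (h : ∀ j : ℕ, q ^ j ≠ -1) (n t : ℕ) :
    dualityConst q n (t + 1) * (1 + q ^ t * (q⁻¹) ^ n) = dualityConst q n t := by
  have e : (n : ℤ) - (t : ℤ) = (n : ℤ) - ((t + 1 : ℕ) : ℤ) + 1 := by push_cast; ring
  have e1 : q ^ t * (q⁻¹) ^ n = q ^ ((t : ℤ) - n) := by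
    rw [zpow_sub₀ hq, zpow_natCast, zpow_natCast, inv_pow, div_eq_mul_inv]
  have e2 : (n : ℤ) * (t : ℤ) - (t.choose 2 : ℤ) =
      ((n : ℤ) * ((t + 1 : ℕ) : ℤ) - ((t + 1).choose 2 : ℤ)) + ((t : ℤ) - n) := by
    rw [Nat.choose_succ_succ' t 1, Nat.choose_one_right]; push_cast; ring
  have e3 : q ^ ((t : ℤ) - n) * q ^ ((n : ℤ) - t) = 1 := by
    rw [← zpow_add₀ hq]; simp
  rw [dualityConst, dualityConst, e1, e, qPochInt_neg_succ hq h, e2, zpow_add₀ hq, ← e]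
  linear_combination -q ^ ((n : ℤ) * ((t + 1 : ℕ) : ℤ) - ((t + 1).choose 2 : ℤ)) *
    qPochInt (-q) q ((n : ℤ) - ((t + 1 : ℕ) : ℤ)) * e3

/-! ### Interpolation and proof of the duality -/

variable [LinearOrder ι] [LinearOrder κ]

/-- Counting zeros: 2|I| from the x's by `h`, 2|T| from the cancelled poles, and `p`, one more than
the degree allows. Genericity keeps them distinct. -/
theorem clearedDiff_eq_zero {q : K} {x : ι → K} {z : κ → K} (g : Generic q x z) {I : Finset ι}
    {T : Finset κ} {C : K}
    (h : ∀ i ∈ I, sumX q x z (I.erase i) T = C * (q⁻¹) ^ I.card * sumZ q x z (I.erase i) T)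
    {p : K} (hpx : ∀ i ∈ I, p ≠ x i ∧ p ≠ (x i)⁻¹) (hpz : ∀ a ∈ T, p ≠ z a ∧ p ≠ (q * z a)⁻¹)
    (hp : clearedDiff q x z I T C p = 0) (Z : K) : clearedDiff q x z I T C Z = 0 := by
  classical
  have hx : ∀ i ∈ I, ∀ ε, clearedDiff q x z I T C (signPow (x i) ε) = 0 := by
    intro i hi ε
    have h1 := h i hi
    rw [← Finset.card_erase_add_one hi] at h1
    simpa [Finset.insert_erase hi] using
      clearedDiff_signPow g (Finset.notMem_erase i I) T C ε h1
  have hz : ∀ a ∈ T, clearedDiff q x z I T C (z a) = 0 := fun a ha => by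
    simpa [Finset.insert_erase ha] using clearedDiff_pole g I (Finset.notMem_erase a T) C
  have hz' : ∀ a ∈ T, clearedDiff q x z I T C (q * z a)⁻¹ = 0 := fun a ha => by
    simpa only [Finset.insert_erase ha] using
      clearedDiff_pole_inv g I (Finset.notMem_erase a T) C
  have hq := g.q_ne
  have xinj : Function.Injective x := fun i j hij => by
    by_contra hne
    exact g.xx_ne i j hne hij
  have zinj : Function.Injective z := fun i j hij => by
    by_contra hne
    exact g.zz_ne i j hne hij
  have xinj' : Function.Injective fun i => (x i)⁻¹ := inv_injective.comp xinj
  have zinj' : Function.Injective fun a => (q * z a)⁻¹ :=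
    inv_injective.comp ((mul_right_injective₀ hq).comp zinj)
  have d1 : Disjoint (I.image x) (I.image fun i => (x i)⁻¹) := by
    simp only [Finset.disjoint_left, Finset.mem_image]
    rintro _ ⟨i, -, rfl⟩ ⟨j, -, hj⟩
    exact g.xx_mul j i (by rw [← hj]; exact mul_inv_cancel₀ (g.x_ne j))
  have d2 : Disjoint (T.image z) (T.image fun a => (q * z a)⁻¹) := by
    simp only [Finset.disjoint_left, Finset.mem_image]
    rintro _ ⟨i, -, rfl⟩ ⟨j, -, hj⟩
    exact g.qzz_mul j i (by
      rw [← hj, ← mul_assoc]; exact mul_inv_cancel₀ (mul_ne_zero hq (g.z_ne j)))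
  have d3 : Disjoint (I.image x ∪ I.image fun i => (x i)⁻¹)
      (T.image z ∪ T.image fun a => (q * z a)⁻¹) := by
    simp only [Finset.disjoint_left, Finset.mem_union, Finset.mem_image]
    rintro _ (⟨i, -, rfl⟩ | ⟨i, -, rfl⟩) (⟨j, -, hj⟩ | ⟨j, -, hj⟩)
    · exact g.zx_ne j i hj
    · exact g.qzx_mul j i (by
        rw [← hj, ← mul_assoc]; exact mul_inv_cancel₀ (mul_ne_zero hq (g.z_ne j)))
    · exact g.zx_mul j i (by rw [hj]; exact inv_mul_cancel₀ (g.x_ne i))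
    · exact g.qzx_ne j i (inv_injective hj)
  have hpn : p ∉ (I.image x ∪ I.image fun i => (x i)⁻¹) ∪
      (T.image z ∪ T.image fun a => (q * z a)⁻¹) := by
    simp only [Finset.mem_union, Finset.mem_image]
    rintro ((⟨i, hi, h1⟩ | ⟨i, hi, h1⟩) | (⟨i, hi, h1⟩ | ⟨i, hi, h1⟩))
    · exact (hpx i hi).1 h1.symm
    · exact (hpx i hi).2 h1.symm
    · exact (hpz i hi).1 h1.symm
    · exact (hpz i hi).2 h1.symm
  refine (isPolyFun_clearedDiff q x z I T C).eq_zero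
    (s := insert p ((I.image x ∪ I.image fun i => (x i)⁻¹) ∪
      (T.image z ∪ T.image fun a => (q * z a)⁻¹))) ?_ ?_ Z
  · rw [Finset.card_insert_of_notMem hpn, Finset.card_union_of_disjoint d3,
      Finset.card_union_of_disjoint d1, Finset.card_union_of_disjoint d2,
      Finset.card_image_of_injective _ xinj, Finset.card_image_of_injective _ zinj,
      Finset.card_image_of_injective _ xinj',
      Finset.card_image_of_injective _ zinj']
    omega
  · simp only [Finset.mem_insert, Finset.mem_union, Finset.mem_image]
    rintro _ (rfl | ((⟨i, hi, rfl⟩ | ⟨i, hi, rfl⟩) | (⟨i, hi, rfl⟩ | ⟨i, hi, rfl⟩)))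
    · exact hp
    · exact hx i hi false
    · exact hx i hi true
    · exact hz i hi
    · exact hz' i hi

theorem sumX_eq_of_clearedDiff {q : K} {x : ι → K} {z : κ → K} (g : Generic q x z) {I : Finset ι}
    {T : Finset κ} {s : κ} (hs : s ∉ T) {C : K} (h : clearedDiff q x z I T C (z s) = 0) :
    sumX q x z I (insert s T) = C * sumZ q x z I (insert s T) := by
  rw [clearedDiff_apply g I hs, mul_eq_zero, mul_eq_zero, sub_eq_zero] at h
  rcases h with (h | h) | h
  · obtain ⟨a, ha, h⟩ := Finset.prod_eq_zero_iff.1 h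
    rcases mul_eq_zero.1 h with h | h
    · exact absurd ((div_eq_one_iff_eq (g.z_ne a)).1 (sub_eq_zero.1 h).symm)
        (g.zz_ne _ _ fun h => hs (h ▸ ha))
    · exact absurd (by rw [← mul_assoc]; exact (sub_eq_zero.1 h).symm) (g.qzz_mul s a)
  · obtain ⟨i, -, h⟩ := Finset.prod_eq_zero_iff.1 h
    rcases mul_eq_zero.1 h with h | h
    · exact absurd h (g.mul_sub s i)
    · exact absurd h (g.div_sub s i)
  · exact h

/-- The duality between the sums over signs of the two sets of variables. -/
theorem sumX_eq_sumZ {q : K} {x : ι → K} {z : κ → K} (g : Generic q x z) (I : Finset ι)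
    (T : Finset κ) : sumX q x z I T = dualityConst q I.card T.card * sumZ q x z I T := by
  have hq := g.q_ne
  induction hn : I.card generalizing I T with
  | zero =>
    obtain rfl := Finset.card_eq_zero.1 hn
    -- Without x's the additional zero is Z = 0, where the identity for the smaller `T` applies.
    induction T using Finset.induction_on with
    | empty => simp [sumX, sumZ, dualityConst_zero]
    | insert s T hs ih =>
      rw [Finset.card_insert_of_notMem hs]
      refine sumX_eq_of_clearedDiff g hs (clearedDiff_eq_zero g (p := 0) (by simp) (by simp) (fun a _ =>
        ⟨(g.z_ne a).symm, (inv_ne_zero (mul_ne_zero hq (g.z_ne a))).symm⟩) ?_ _)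
      rw [clearedDiff_zero, ih, ← dualityConst_succ hq g.q_pow, Finset.card_empty]
      ring
  | succ n ih =>
    obtain ⟨i, hi⟩ : I.Nonempty := Finset.card_pos.1 (by omega)
    -- The index `T.card + 1` counts Z. The additional zero is now (q x_i)⁻¹, so only the induction
    -- on the number of x's is needed.
    have key : ∀ (T : Finset κ) (Z : K),
        clearedDiff q x z I T (dualityConst q (n + 1) (T.card + 1)) Z = 0 := by
      intro T
      have h : ∀ i ∈ I, sumX q x z (I.erase i) T =
          dualityConst q (n + 1) (T.card + 1) * (q⁻¹) ^ I.card * sumZ q x z (I.erase i) T := by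
        intro i hi
        rw [hn, dualityConst_succ_succ hq]
        exact ih _ T (by rw [Finset.card_erase_of_mem hi, hn, Nat.add_sub_cancel])
      have hi' := h i hi
      rw [← Finset.card_erase_add_one hi] at hi'
      have hex := clearedDiff_extra g (Finset.notMem_erase i I) T _ hi'
      rw [Finset.insert_erase hi] at hex
      have hqx := mul_ne_zero hq (g.x_ne i)
      refine clearedDiff_eq_zero g h (fun j _ => ⟨fun h => ?_, fun h => ?_⟩)
        (fun a _ => ⟨fun h => ?_, fun h => ?_⟩) hex
      · exact g.qxx_mul i j (by rw [← mul_assoc, ← h]; exact mul_inv_cancel₀ hqx)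
      · exact g.qxx_ne i j (inv_injective h)
      · exact g.qzx_mul a i (by
          rw [← h, mul_comm _ (x i), ← mul_assoc]; exact mul_inv_cancel₀ hqx)
      · exact g.zx_ne a i (mul_left_cancel₀ hq (inv_injective h).symm)
    induction T using Finset.induction_on with
    | empty =>
      -- With no z there is nothing to substitute for Z; setting Z = 0 removes the free variable
      -- instead.
      have := key ∅ 0
      rw [clearedDiff_zero, sub_eq_zero, ← mul_assoc, hn, Finset.card_empty,
        dualityConst_succ hq g.q_pow] at this
      simpa using this
    | insert s T hs _ =>
      rw [Finset.card_insert_of_notMem hs]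
      exact sumX_eq_of_clearedDiff g hs (key T _)

end multiplicityOne

/-! ### Products of two-point weights over geometric progressions -/

section blocks

variable {K : Type*} [Field K]

theorem qPoch_zero (a q : K) : qPoch a q 0 = 1 := by simp [qPoch]

theorem qPoch_succ (a q : K) (n : ℕ) : qPoch a q (n + 1) = qPoch a q n * (1 - a * q ^ n) := by
  simp [qPoch, Finset.prod_range_succ]

theorem qPoch_add (a q : K) (m n : ℕ) :
    qPoch a q (m + n) = qPoch a q m * qPoch (a * q ^ m) q n := by
  simp only [qPoch, Finset.prod_range_add]
  congr 1
  exact Finset.prod_congr rfl fun i _ => by rw [pow_add, mul_assoc]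

/-- Splits the factors of (q c; q)_(2k) by the parity of the exponent of q. -/
theorem qPoch_mul_qPoch_eq (q c : K) (k : ℕ) :
    qPoch (q * c) q (k + k) = qPoch (q * c) (q ^ 2) k * ∏ e ∈ Finset.range k,
      (1 - q ^ (2 + e + e) * c) := by
  induction k with
  | zero => simp [qPoch]
  | succ k ih =>
    have : k + 1 + (k + 1) = k + k + 1 + 1 := by ring
    rw [this, qPoch_succ, qPoch_succ, ih, qPoch_succ, Finset.prod_range_succ]
    ring

theorem prod_Ico_telescope {f F : ℕ → K} {a b : ℕ} (hab : a ≤ b)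
    (hF : ∀ i, a ≤ i → i ≤ b → F i ≠ 0)
    (h : ∀ i, a ≤ i → i < b → f i = F (i + 1) / F i) : ∏ i ∈ Finset.Ico a b, f i = F b / F a := by
  induction b, hab using Nat.le_induction with
  | base => simp [div_self (hF a le_rfl le_rfl)]
  | succ b hab ih =>
    rw [Finset.prod_Ico_succ_top hab, ih (fun i h1 h2 => hF i h1 (by omega))
      (fun i h1 h2 => h i h1 (by omega)), h b hab (by omega)]
    have h1 := hF a le_rfl (by omega)
    have h2 := hF b hab (by omega)
    field_simp

/-- The product of the two-point weights of an element of one block, with sign `ε`, with the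
elements of another block, the first `m` of which have negative sign. -/
def rowProd (q u v : K) (k m e : ℕ) (ε : Bool) : K :=
  ∏ f ∈ Finset.range k, pairKernel q (dualArg q (q ^ e * u) (q ^ f * v) ε (decide (f < m)))

/-- Up to a power of q, the denominator of each kernel is the numerator of the next; the factor q^f
in `F` absorbs that power. Only `f ≤ m` is required, so that u = v is allowed inside a block. -/
theorem prod_kernel_pos_neg {q u v : K} (hq : q ≠ 0) (hv : v ≠ 0) {m e : ℕ}
    (h : ∀ f ≤ m, q ^ f * v ≠ q ^ (e + 1) * u) :
    ∏ f ∈ Finset.range m, pairKernel q (dualArg q (q ^ e * u) (q ^ f * v) false true) =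
      q ^ m * (v - q ^ (e + 1) * u) / (q ^ m * v - q ^ (e + 1) * u) := by
  rw [Finset.range_eq_Ico, prod_Ico_telescope (F := fun f => q ^ f / (q ^ f * v - q ^ (e + 1) * u))
    (Nat.zero_le m)]
  · have h1 := sub_ne_zero.2 (h m le_rfl)
    have h2 := sub_ne_zero.2 (h 0 (Nat.zero_le m))
    rw [pow_zero, one_mul] at h2 ⊢
    rw [one_div, div_inv_eq_mul]
    ring
  · exact fun i _ hi => div_ne_zero (pow_ne_zero _ hq) (sub_ne_zero.2 (h i hi))
  · intro f _ hf
    have h1 := sub_ne_zero.2 (h (f + 1) (by omega))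
    have h2 := sub_ne_zero.2 (h f (by omega))
    have h3 : q ^ f * v ≠ 0 := mul_ne_zero (pow_ne_zero _ hq) hv
    have h4 : q ^ f * v - q ^ e * u ≠ 0 := fun h0 => h1 (by linear_combination q * h0)
    have h5 : q ^ (f + 1) * v - q ^ (e + 1) * u = q * (q ^ f * v - q ^ e * u) := by ring
    simp only [pairKernel, dualArg]
    rw [h5, mul_div_assoc', one_sub_div h3, one_sub_div h3]
    field_simp
    ring

theorem prod_kernel_pos_pos {q u v : K} {a b e : ℕ} (hab : a ≤ b)
    (h : ∀ j, 1 ≤ j → q ^ j * (u * v) ≠ 1) :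
    ∏ f ∈ Finset.Ico a b, pairKernel q (dualArg q (q ^ e * u) (q ^ f * v) false false) =
      (1 - q ^ (1 + e + b) * (u * v)) / (1 - q ^ (1 + e + a) * (u * v)) := by
  refine prod_Ico_telescope (F := fun f => 1 - q ^ (1 + e + f) * (u * v)) hab
    (fun i _ _ => sub_ne_zero.2 (h _ (by omega)).symm) fun f _ _ => ?_
  simp only [pairKernel, dualArg]
  congr 1 <;> ring

theorem prod_kernel_neg_neg {q u v : K} (hq : q ≠ 0) (hu : u ≠ 0) (hv : v ≠ 0) {m e : ℕ}
    (h : ∀ j, q ^ j * (u * v) ≠ 1) :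
    ∏ f ∈ Finset.range m, pairKernel q (dualArg q (q ^ e * u) (q ^ f * v) true true) =
      q ^ m * (1 - q ^ e * (u * v)) / (1 - q ^ (e + m) * (u * v)) := by
  have hF : ∀ i, 1 - q ^ (e + i) * (u * v) ≠ 0 := fun i => sub_ne_zero.2 (h _).symm
  rw [Finset.range_eq_Ico, prod_Ico_telescope (F := fun f => q ^ f / (1 - q ^ (e + f) * (u * v)))
    (Nat.zero_le m)]
  · have h1 := hF 0
    simp only [pow_zero, add_zero, one_div, div_inv_eq_mul]
    ring
  · exact fun i _ hi => div_ne_zero (pow_ne_zero _ hq) (hF i)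
  · intro f _ hf
    have h1 := hF f
    have h2 := hF (f + 1)
    have h3 : q * (q ^ e * u * (q ^ f * v)) ≠ 0 :=
      mul_ne_zero hq (mul_ne_zero (mul_ne_zero (pow_ne_zero _ hq) hu)
        (mul_ne_zero (pow_ne_zero _ hq) hv))
    have h4 : 1 - (q * (q ^ e * u * (q ^ f * v)))⁻¹ =
        -(1 - q ^ (e + (f + 1)) * (u * v)) / (q * (q ^ e * u * (q ^ f * v))) := by
      rw [inv_eq_one_div, one_sub_div h3]; ring
    have h5 : 1 - q * (q * (q ^ e * u * (q ^ f * v)))⁻¹ =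
        -q * (1 - q ^ (e + f) * (u * v)) / (q * (q ^ e * u * (q ^ f * v))) := by
      rw [inv_eq_one_div, mul_one_div, one_sub_div h3]; ring
    simp only [pairKernel, dualArg]
    rw [h4, h5, div_div_div_cancel_right₀ h3, neg_mul, neg_div_neg_eq, div_div_eq_mul_div,
      div_mul_eq_mul_div, div_div, div_eq_div_iff h2 (mul_ne_zero h2 (pow_ne_zero _ hq))]
    ring

theorem prod_kernel_neg_pos {q u v : K} (hq : q ≠ 0) (hu : u ≠ 0) {a b e : ℕ} (hab : a ≤ b)
    (h : ∀ f, a ≤ f → q ^ e * u ≠ q ^ f * v) :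
    ∏ f ∈ Finset.Ico a b, pairKernel q (dualArg q (q ^ e * u) (q ^ f * v) true false) =
      (q ^ e * u - q ^ b * v) / (q ^ e * u - q ^ a * v) := by
  refine prod_Ico_telescope (F := fun f => q ^ e * u - q ^ f * v) hab
    (fun i hi _ => sub_ne_zero.2 (h i hi)) fun f hf _ => ?_
  have h1 : q ^ e * u ≠ 0 := mul_ne_zero (pow_ne_zero _ hq) hu
  simp only [pairKernel, dualArg]
  rw [mul_div_assoc', one_sub_div h1, one_sub_div h1, div_div_div_cancel_right₀ h1]
  ring

theorem prod_range_split {f g h : ℕ → K} {m k : ℕ} (hmk : m ≤ k) (hg : ∀ i < m, f i = g i)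
    (hh : ∀ i, m ≤ i → f i = h i) :
    ∏ i ∈ Finset.range k, f i = (∏ i ∈ Finset.range m, g i) * ∏ i ∈ Finset.Ico m k, h i := by
  rw [← Finset.prod_range_mul_prod_Ico f hmk]
  congr 1
  · exact Finset.prod_congr rfl fun i hi => hg i (Finset.mem_range.1 hi)
  · exact Finset.prod_congr rfl fun i hi => hh i (Finset.mem_Ico.1 hi).1

theorem rowProd_false {q u v : K} (hq : q ≠ 0) (hv : v ≠ 0)
    (h1 : ∀ e f, q ^ e * u ≠ q ^ f * v) (h2 : ∀ j, q ^ j * (u * v) ≠ 1) {k m : ℕ} (hm : m ≤ k)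
    (e : ℕ) : rowProd q u v k m e false =
      q ^ m * (v - q ^ (e + 1) * u) / (q ^ m * v - q ^ (e + 1) * u) *
      ((1 - q ^ (1 + e + k) * (u * v)) / (1 - q ^ (1 + e + m) * (u * v))) := by
  rw [rowProd, prod_range_split hm
    (g := fun f => pairKernel q (dualArg q (q ^ e * u) (q ^ f * v) false true))
    (h := fun f => pairKernel q (dualArg q (q ^ e * u) (q ^ f * v) false false))
    (fun i hi => by simp [hi]) (fun i hi => by simp [not_lt.2 hi]),
    prod_kernel_pos_neg hq hv (fun f _ => (h1 _ _).symm), prod_kernel_pos_pos hm fun j _ => h2 j]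

theorem rowProd_true {q u v : K} (hq : q ≠ 0) (hu : u ≠ 0) (hv : v ≠ 0)
    (h1 : ∀ e f, q ^ e * u ≠ q ^ f * v) (h2 : ∀ j, q ^ j * (u * v) ≠ 1) {k m : ℕ} (hm : m ≤ k)
    (e : ℕ) : rowProd q u v k m e true =
      q ^ m * (1 - q ^ e * (u * v)) / (1 - q ^ (e + m) * (u * v)) *
      ((q ^ e * u - q ^ k * v) / (q ^ e * u - q ^ m * v)) := by
  rw [rowProd, prod_range_split hm
    (g := fun f => pairKernel q (dualArg q (q ^ e * u) (q ^ f * v) true true))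
    (h := fun f => pairKernel q (dualArg q (q ^ e * u) (q ^ f * v) true false))
    (fun i hi => by simp [hi]) (fun i hi => by simp [not_lt.2 hi]),
    prod_kernel_neg_neg hq hu hv h2, prod_kernel_neg_pos hq hu hm fun f _ => h1 _ _]

/-- The product of the two-point weights between two blocks. -/
def crossPairs (q u v : K) (k k' m m' : ℕ) : K :=
  ∏ e ∈ Finset.range k, rowProd q u v k' m' e (decide (e < m))

/-- The factor of the coefficient that belongs to an ordered pair of blocks. -/
def shiftCoeff (q u v : K) (k' m : ℕ) : K :=
  (qPoch (q ^ (-(k' : ℤ)) * (u / v)) q m / qPoch (q * (u / v)) q m) *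
    (qPoch (u * v) q m / qPoch (q ^ (1 + k') * (u * v)) q m)

/-- The factor of the coefficient that belongs to a pair of distinct blocks. -/
def crossCoeff (q u v : K) (k k' m m' : ℕ) : K :=
  (q ^ m * u - q ^ m' * v) / (u - v) * ((1 - q ^ (m + m') * u * v) / (1 - u * v)) *
    (shiftCoeff q u v k' m * shiftCoeff q v u k m') *
    (qPoch (q ^ (k' + 1) * (u * v)) q k / qPoch (q * (u * v)) q k) * q ^ (k' * m + k * m')

/-- The product of the two-point weights inside a block. -/
def innerPairs (q u : K) (k m : ℕ) : K :=
  ∏ e ∈ Finset.range k, ∏ f ∈ Finset.range k with e < f,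
    pairKernel q (dualArg q (q ^ e * u) (q ^ f * u) (decide (e < m)) (decide (f < m)))

/-- The factor of the coefficient that belongs to a single block. -/
def innerCoeff (q u : K) (k m : ℕ) : K :=
  (1 - q ^ (m + m) * u * u) / (1 - u * u) * shiftCoeff q u u k m *
    (qPoch (q * u ^ 2) (q ^ 2) k / qPoch (q * u ^ 2) q k) * ((-1) ^ m * q ^ (k * m))

theorem qPoch_ne_zero {a q : K} {n : ℕ} (h : ∀ i < n, a * q ^ i ≠ 1) : qPoch a q n ≠ 0 :=
  Finset.prod_ne_zero_iff.2 fun i hi => sub_ne_zero.2 (h i (Finset.mem_range.1 hi)).symm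

theorem crossPairs_symm (q u v : K) (k k' m m' : ℕ) :
    crossPairs q u v k k' m m' = crossPairs q v u k' k m' m := by
  unfold crossPairs rowProd
  rw [Finset.prod_comm]
  refine Finset.prod_congr rfl fun i _ => Finset.prod_congr rfl fun j _ => ?_
  rw [dualArg_comm]

theorem crossCoeff_symm {q u v : K} (h2 : ∀ j, q ^ j * (u * v) ≠ 1) (k k' m m' : ℕ) :
    crossCoeff q u v k k' m m' = crossCoeff q v u k' k m' m := by
  have hne : ∀ n, qPoch (q * (u * v)) q n ≠ 0 := fun n => qPoch_ne_zero fun i _ h => h2 (i + 1)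
    (by rw [← h]; ring)
  -- Both sides are (quv; q)_(k+k') / ((quv; q)_k (quv; q)_k').
  have e : qPoch (q ^ (k' + 1) * (u * v)) q k / qPoch (q * (u * v)) q k =
      qPoch (q ^ (k + 1) * (u * v)) q k' / qPoch (q * (u * v)) q k' := by
    rw [div_eq_div_iff (hne _) (hne _)]
    have h3 := qPoch_add (q * (u * v)) q k k'
    rw [add_comm, qPoch_add] at h3
    have e1 : ∀ n, q * (u * v) * q ^ n = q ^ (n + 1) * (u * v) := fun n => by ring
    rw [e1, e1] at h3
    linear_combination h3
  unfold crossCoeff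
  rw [e, mul_comm v u, ← neg_sub v u, ← neg_sub (q ^ m' * v), neg_div_neg_eq, add_comm m' m,
    add_comm (k' * m), mul_right_comm _ v u, mul_comm (shiftCoeff q u v k' m)]

theorem rowProd_false_ne_zero {q u v : K} (hq : q ≠ 0) (hv : v ≠ 0)
    (h1 : ∀ e f, q ^ e * u ≠ q ^ f * v) (h2 : ∀ j, q ^ j * (u * v) ≠ 1) {k m : ℕ} (hm : m ≤ k)
    (e : ℕ) : rowProd q u v k m e false ≠ 0 := by
  rw [rowProd_false hq hv h1 h2 hm]
  have h3 : v - q ^ (e + 1) * u ≠ 0 := sub_ne_zero.2 fun h => h1 (e + 1) 0 (by simp [← h])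
  exact mul_ne_zero (div_ne_zero (mul_ne_zero (pow_ne_zero _ hq) h3)
    (sub_ne_zero.2 (h1 _ _).symm)) (div_ne_zero (sub_ne_zero.2 (h2 _).symm)
      (sub_ne_zero.2 (h2 _).symm))

/-- Passing from `m` to `m + 1` flips only the element of exponent `m`, so one row changes. -/
theorem crossPairs_succ (q u v : K) {k k' m m' : ℕ} (hm : m < k) :
    crossPairs q u v k k' (m + 1) m' * rowProd q u v k' m' m false =
      crossPairs q u v k k' m m' * rowProd q u v k' m' m true := by
  unfold crossPairs
  have hmem := Finset.mem_range.2 hm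
  rw [← Finset.mul_prod_erase _ _ hmem, ← Finset.mul_prod_erase _ _ hmem]
  have : ∏ e ∈ (Finset.range k).erase m, rowProd q u v k' m' e (decide (e < m + 1)) =
      ∏ e ∈ (Finset.range k).erase m, rowProd q u v k' m' e (decide (e < m)) := by
    refine Finset.prod_congr rfl fun e he => ?_
    have hne := Finset.ne_of_mem_erase he
    congr 2
    rw [eq_iff_iff]
    omega
  rw [this]
  simp only [lt_irrefl, decide_false, Nat.lt_succ_self, decide_true]
  ring

theorem shiftCoeff_succ {q u v : K} (hq : q ≠ 0) (hv : v ≠ 0) (k m : ℕ) :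
    shiftCoeff q u v k (m + 1) = shiftCoeff q u v k m *
      (((q ^ k * v - q ^ m * u) / (q ^ k * (v - q ^ (m + 1) * u))) *
        ((1 - q ^ m * (u * v)) / (1 - q ^ (1 + m + k) * (u * v)))) := by
  have hqk : q ^ k ≠ 0 := pow_ne_zero _ hq
  have e1 : 1 - q ^ (-(k : ℤ)) * (u / v) * q ^ m = (q ^ k * v - q ^ m * u) / (q ^ k * v) := by
    rw [zpow_neg, zpow_natCast]
    field_simp
  have e2 : 1 - q * (u / v) * q ^ m = (v - q ^ (m + 1) * u) / v := by
    field_simp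
    ring
  have e3 : q ^ (1 + k) * (u * v) * q ^ m = q ^ (1 + m + k) * (u * v) := by ring
  have e4 : (q ^ k * v - q ^ m * u) / (q ^ k * (v - q ^ (m + 1) * u)) =
      ((q ^ k * v - q ^ m * u) / (q ^ k * v)) / ((v - q ^ (m + 1) * u) / v) := by
    rw [div_div_eq_mul_div, div_mul_eq_mul_div, div_div, mul_right_comm (q ^ k),
      mul_div_mul_right _ _ hv]
  unfold shiftCoeff
  rw [qPoch_succ, qPoch_succ, qPoch_succ, qPoch_succ, e1, e2, e3, e4, mul_comm (u * v) (q ^ m)]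
  simp only [div_eq_mul_inv, mul_inv]
  ring

/-- The explicit coefficient obeys the recursion of `crossPairs_succ`, so the two need only be
compared at `m = 0`. -/
theorem crossCoeff_succ {q u v : K} (hq : q ≠ 0) (hu : u ≠ 0) (hv : v ≠ 0)
    (h1 : ∀ e f, q ^ e * u ≠ q ^ f * v) (h2 : ∀ j, q ^ j * (u * v) ≠ 1) {k k' m m' : ℕ}
    (hm' : m' ≤ k') :
    crossCoeff q u v k k' (m + 1) m' * rowProd q u v k' m' m false =
      crossCoeff q u v k k' m m' * rowProd q u v k' m' m true := by
  have a1 : ∀ e f, q ^ e * u - q ^ f * v ≠ 0 := fun e f => sub_ne_zero.2 (h1 e f)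
  have a2 : ∀ j, 1 - q ^ j * (u * v) ≠ 0 := fun j => sub_ne_zero.2 (h2 j).symm
  have a3 : v - q ^ (m + 1) * u ≠ 0 := sub_ne_zero.2 fun h => h1 (m + 1) 0 (by simp [← h])
  have a4 : q ^ m' * v - q ^ (m + 1) * u ≠ 0 := sub_ne_zero.2 (h1 _ _).symm
  have key : (q ^ (m + 1) * u - q ^ m' * v) * (1 - q ^ (m + 1 + m') * (u * v)) *
      (((q ^ k' * v - q ^ m * u) / (q ^ k' * (v - q ^ (m + 1) * u))) *
        ((1 - q ^ m * (u * v)) / (1 - q ^ (1 + m + k') * (u * v)))) * q ^ k' *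
      (q ^ m' * (v - q ^ (m + 1) * u) / (q ^ m' * v - q ^ (m + 1) * u) *
      ((1 - q ^ (1 + m + k') * (u * v)) / (1 - q ^ (1 + m + m') * (u * v)))) =
      (q ^ m * u - q ^ m' * v) * (1 - q ^ (m + m') * (u * v)) *
      (q ^ m' * (1 - q ^ m * (u * v)) / (1 - q ^ (m + m') * (u * v)) *
      ((q ^ m * u - q ^ k' * v) / (q ^ m * u - q ^ m' * v))) := by
    have b1 := a1 m m'
    have b2 := a2 (m + m')
    have b3 := a2 (1 + m + k')
    have b4 := a2 (1 + m + m')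
    have b5 : q ^ (m + 1) * u - q ^ m' * v = -(q ^ m' * v - q ^ (m + 1) * u) := by ring
    have b6 : q ^ m * u - q ^ k' * v = -(q ^ k' * v - q ^ m * u) := by ring
    rw [add_right_comm m 1 m', add_comm (m + m') 1, ← add_assoc, b5, b6]
    -- Only cancellation is left, so the linear factors may be treated as atoms.
    generalize q ^ m' * v - q ^ (m + 1) * u = A1 at *
    generalize q ^ m * u - q ^ m' * v = A2 at *
    generalize 1 - q ^ (m + m') * (u * v) = A3 at *
    generalize 1 - q ^ (1 + m + k') * (u * v) = A4 at *
    generalize 1 - q ^ (1 + m + m') * (u * v) = A5 at *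
    generalize v - q ^ (m + 1) * u = A6 at *
    field_simp
  rw [rowProd_false hq hv h1 h2 hm', rowProd_true hq hu hv h1 h2 hm', crossCoeff, crossCoeff,
    shiftCoeff_succ hq hv]
  have e : q ^ (k' * (m + 1) + k * m') = q ^ (k' * m + k * m') * q ^ k' := by ring
  rw [e]
  simp only [mul_assoc _ u v, div_eq_mul_inv] at key ⊢
  linear_combination (u + -v)⁻¹ * (1 - u * v)⁻¹ * (shiftCoeff q u v k' m * shiftCoeff q v u k m') *
    (qPoch (q ^ (k' + 1) * (u * v)) q k * (qPoch (q * (u * v)) q k)⁻¹) *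
    q ^ (k' * m + k * m') * key

theorem crossPairs_eq_of_zero {q u v : K} (hq : q ≠ 0) (hu : u ≠ 0) (hv : v ≠ 0)
    (h1 : ∀ e f, q ^ e * u ≠ q ^ f * v) (h2 : ∀ j, q ^ j * (u * v) ≠ 1) {k k' m' : ℕ}
    (hm' : m' ≤ k') (h0 : crossPairs q u v k k' 0 m' = crossCoeff q u v k k' 0 m') {m : ℕ}
    (hm : m ≤ k) : crossPairs q u v k k' m m' = crossCoeff q u v k k' m m' := by
  induction m with
  | zero => exact h0
  | succ m ih =>
    refine mul_right_cancel₀ (rowProd_false_ne_zero hq hv h1 h2 hm' m) ?_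
    rw [crossPairs_succ q u v (by omega), crossCoeff_succ hq hu hv h1 h2 hm', ih (by omega)]

/-- The symmetry of both sides allows the recursion in either block, which reduces everything to `m
= m' = 0`; there the rows telescope. -/
theorem crossPairs_eq {q u v : K} (hq : q ≠ 0) (hu : u ≠ 0) (hv : v ≠ 0)
    (h1 : ∀ e f, q ^ e * u ≠ q ^ f * v) (h2 : ∀ j, q ^ j * (u * v) ≠ 1) {k k' m m' : ℕ}
    (hm : m ≤ k) (hm' : m' ≤ k') : crossPairs q u v k k' m m' = crossCoeff q u v k k' m m' := by
  have h2' : ∀ j, q ^ j * (v * u) ≠ 1 := fun j => by rw [mul_comm v u]; exact h2 j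
  refine crossPairs_eq_of_zero hq hu hv h1 h2 hm' ?_ hm
  rw [crossPairs_symm, crossCoeff_symm h2]
  refine crossPairs_eq_of_zero hq hv hu (fun e f => (h1 f e).symm) h2' (Nat.zero_le k) ?_ hm'
  rw [← crossPairs_symm, ← crossCoeff_symm h2]
  have a1 : u - v ≠ 0 := sub_ne_zero.2 (by simpa using h1 0 0)
  have a2 : 1 - u * v ≠ 0 := sub_ne_zero.2 (by simpa using (h2 0).symm)
  have hL : crossPairs q u v k k' 0 0 =
      ∏ e ∈ Finset.range k, (1 - q ^ (1 + e + k') * (u * v)) / (1 - q ^ (1 + e) * (u * v)) := by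
    refine Finset.prod_congr rfl fun e _ => ?_
    have a3 : v - q ^ (e + 1) * u ≠ 0 := sub_ne_zero.2 fun h => h1 (e + 1) 0 (by simp [← h])
    rw [Nat.not_lt_zero e |> decide_eq_false, rowProd_false hq hv h1 h2 (Nat.zero_le _)]
    simp [div_self a3]
  rw [hL, crossCoeff]
  simp only [shiftCoeff, qPoch_zero, pow_zero, one_mul, div_self a1, add_zero, div_self a2, mul_zero,
    mul_one, div_one]
  rw [Finset.prod_div_distrib, qPoch, qPoch]
  congr 1 <;> exact Finset.prod_congr rfl fun i _ => by ring

theorem prod_range_erase {k m : ℕ} (f : ℕ → K) (hm : m < k) :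
    ∏ j ∈ (Finset.range k).erase m, f j =
      (∏ j ∈ Finset.range m, f j) * ∏ j ∈ Finset.Ico (m + 1) k, f j := by
  rw [← Finset.prod_union (by
    rw [Finset.disjoint_left]
    intro a h1 h2
    rw [Finset.mem_range] at h1
    rw [Finset.mem_Ico] at h2
    omega)]
  congr 1
  ext j
  simp only [Finset.mem_erase, Finset.mem_range, Finset.mem_union, Finset.mem_Ico]
  omega

theorem pow_mul_ne {q u : K} (hq : q ≠ 0) (hu : u ≠ 0) (h1 : ∀ j, 1 ≤ j → q ^ j ≠ 1) {a b : ℕ}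
    (hab : a < b) : q ^ a * u ≠ q ^ b * u := by
  intro h
  obtain ⟨j, rfl⟩ := Nat.exists_eq_add_of_lt hab
  refine h1 (j + 1) (by omega) (mul_left_cancel₀ (mul_ne_zero (pow_ne_zero a hq) hu) ?_)
  linear_combination -h

/-- Only the element of exponent `m` changes sign; before and after, its partners of smaller
exponent are negative and those of larger exponent positive. The factors are the two telescoped
halves of its row. -/
theorem innerPairs_succ {q u : K} (hq : q ≠ 0) (hu : u ≠ 0) (h1 : ∀ j, 1 ≤ j → q ^ j ≠ 1)
    (h2 : ∀ j, q ^ j * (u * u) ≠ 1) {k m : ℕ} (hm : m < k) :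
    innerPairs q u k (m + 1) * (q ^ m * (u - q ^ (m + 1) * u) / (q ^ m * u - q ^ (m + 1) * u) *
      ((1 - q ^ (1 + m + k) * (u * u)) / (1 - q ^ (1 + m + (m + 1)) * (u * u)))) =
    innerPairs q u k m * (q ^ m * (1 - q ^ m * (u * u)) / (1 - q ^ (m + m) * (u * u)) *
      ((q ^ m * u - q ^ k * u) / (q ^ m * u - q ^ (m + 1) * u))) := by
  have hrow : ∀ (ε : Bool) (M : ℕ), m ≤ M → M ≤ m + 1 → ∏ j ∈ (Finset.range k).erase m,
      pairKernel q (dualArg q (q ^ m * u) (q ^ j * u) ε (decide (j < M))) =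
      (∏ j ∈ Finset.range m, pairKernel q (dualArg q (q ^ m * u) (q ^ j * u) ε true)) *
      ∏ j ∈ Finset.Ico (m + 1) k,
        pairKernel q (dualArg q (q ^ m * u) (q ^ j * u) ε false) := by
    intro ε M hM hM'
    rw [prod_range_erase _ hm]
    congr 1
    · refine Finset.prod_congr rfl fun j hj => ?_
      rw [decide_eq_true ((Finset.mem_range.1 hj).trans_le hM)]
    · refine Finset.prod_congr rfl fun j hj => ?_
      rw [decide_eq_false (not_lt.2 (hM'.trans (Finset.mem_Ico.1 hj).1))]
  have hrest : ∏ i ∈ (Finset.range k).erase m, ∏ j ∈ (Finset.range k).erase m with i < j,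
      pairKernel q (dualArg q (q ^ i * u) (q ^ j * u) (decide (i < m + 1)) (decide (j < m + 1))) =
      ∏ i ∈ (Finset.range k).erase m, ∏ j ∈ (Finset.range k).erase m with i < j,
      pairKernel q (dualArg q (q ^ i * u) (q ^ j * u) (decide (i < m)) (decide (j < m))) := by
    have e : ∀ i ∈ (Finset.range k).erase m, decide (i < m + 1) = decide (i < m) := by
      intro i hi
      have := Finset.ne_of_mem_erase hi
      rw [decide_eq_decide]
      omega
    exact Finset.prod_congr rfl fun i hi => Finset.prod_congr rfl fun j hj => by
      rw [e i hi, e j (Finset.mem_filter.1 hj).1]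
  have hne := Finset.notMem_erase m (Finset.range k)
  have hins : ∀ M, m ≤ M → M ≤ m + 1 → innerPairs q u k M =
      ((∏ j ∈ Finset.range m, pairKernel q (dualArg q (q ^ m * u) (q ^ j * u)
        (decide (m < M)) true)) * ∏ j ∈ Finset.Ico (m + 1) k,
        pairKernel q (dualArg q (q ^ m * u) (q ^ j * u) (decide (m < M)) false)) *
      ∏ i ∈ (Finset.range k).erase m, ∏ j ∈ (Finset.range k).erase m with i < j,
      pairKernel q (dualArg q (q ^ i * u) (q ^ j * u) (decide (i < M)) (decide (j < M))) := by
    intro M hM hM'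
    have := prod_lt_insert (f := fun i j => pairKernel q (dualArg q (q ^ i * u) (q ^ j * u)
      (decide (i < M)) (decide (j < M)))) (fun i j => by rw [dualArg_comm]) hne
    rw [Finset.insert_erase (Finset.mem_range.2 hm), hrow _ M hM hM'] at this
    exact this
  rw [hins m le_rfl (Nat.le_succ m), hins (m + 1) (Nat.le_succ m) le_rfl, hrest,
    decide_eq_true (Nat.lt_succ_self m), decide_eq_false (lt_irrefl m),
    prod_kernel_pos_neg hq hu fun f hf => (pow_mul_ne hq hu h1 (Nat.lt_succ_of_le hf)),
    prod_kernel_neg_neg hq hu hu h2, prod_kernel_pos_pos (show m + 1 ≤ k from hm) fun j _ => h2 j,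
    prod_kernel_neg_pos hq hu (show m + 1 ≤ k from hm) fun f hf => pow_mul_ne hq hu h1 hf]
  ring

theorem innerCoeff_succ {q u : K} (hq : q ≠ 0) (hu : u ≠ 0) (h1 : ∀ j, 1 ≤ j → q ^ j ≠ 1)
    (h2 : ∀ j, q ^ j * (u * u) ≠ 1) (k m : ℕ) :
    innerCoeff q u k (m + 1) * (q ^ m * (u - q ^ (m + 1) * u) / (q ^ m * u - q ^ (m + 1) * u) *
      ((1 - q ^ (1 + m + k) * (u * u)) / (1 - q ^ (1 + m + (m + 1)) * (u * u)))) =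
    innerCoeff q u k m * (q ^ m * (1 - q ^ m * (u * u)) / (1 - q ^ (m + m) * (u * u)) *
      ((q ^ m * u - q ^ k * u) / (q ^ m * u - q ^ (m + 1) * u))) := by
  have a2 : ∀ j, 1 - q ^ j * (u * u) ≠ 0 := fun j => sub_ne_zero.2 (h2 j).symm
  have key : (1 - q ^ (m + 1 + (m + 1)) * (u * u)) *
      (((q ^ k * u - q ^ m * u) / (q ^ k * (u - q ^ (m + 1) * u))) *
        ((1 - q ^ m * (u * u)) / (1 - q ^ (1 + m + k) * (u * u)))) * (-q ^ k) *
      (q ^ m * (u - q ^ (m + 1) * u) / (q ^ m * u - q ^ (m + 1) * u) *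
      ((1 - q ^ (1 + m + k) * (u * u)) / (1 - q ^ (1 + m + (m + 1)) * (u * u)))) =
      (1 - q ^ (m + m) * (u * u)) *
      (q ^ m * (1 - q ^ m * (u * u)) / (1 - q ^ (m + m) * (u * u)) *
      ((q ^ m * u - q ^ k * u) / (q ^ m * u - q ^ (m + 1) * u))) := by
    have b2 := a2 (m + m)
    have b3 := a2 (1 + m + k)
    have b4 := a2 (1 + m + (m + 1))
    have b5 : u - q ^ (m + 1) * u ≠ 0 := by
      simpa using sub_ne_zero.2 (pow_mul_ne hq hu h1 (Nat.succ_pos m))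
    have b6 := sub_ne_zero.2 (pow_mul_ne hq hu h1 (Nat.lt_succ_self m))
    have b7 : q ^ m * u - q ^ k * u = -(q ^ k * u - q ^ m * u) := by ring
    rw [b7, show m + 1 + (m + 1) = 1 + m + (m + 1) by ring]
    generalize q ^ k * u - q ^ m * u = A1 at *
    generalize q ^ m * u - q ^ (m + 1) * u = A2 at *
    generalize 1 - q ^ (m + m) * (u * u) = A3 at *
    generalize 1 - q ^ (1 + m + k) * (u * u) = A4 at *
    generalize 1 - q ^ (1 + m + (m + 1)) * (u * u) = A5 at *
    generalize u - q ^ (m + 1) * u = A6 at *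
    field_simp
  rw [innerCoeff, innerCoeff, shiftCoeff_succ hq hu]
  have e : (-1 : K) ^ (m + 1) * q ^ (k * (m + 1)) = (-1) ^ m * q ^ (k * m) * (-q ^ k) := by ring
  rw [e]
  simp only [mul_assoc _ u u, div_eq_mul_inv] at key ⊢
  linear_combination (1 - u * u)⁻¹ * shiftCoeff q u u k m *
    (qPoch (q * u ^ 2) (q ^ 2) k * (qPoch (q * u ^ 2) q k)⁻¹) * ((-1) ^ m * q ^ (k * m)) * key

theorem innerPairs_eq {q u : K} (hq : q ≠ 0) (hu : u ≠ 0) (h1 : ∀ j, 1 ≤ j → q ^ j ≠ 1)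
    (h2 : ∀ j, q ^ j * (u * u) ≠ 1) {k m : ℕ} (hm : m ≤ k) :
    innerPairs q u k m = innerCoeff q u k m := by
  have a2 : ∀ j, 1 - q ^ j * (u * u) ≠ 0 := fun j => sub_ne_zero.2 (h2 j).symm
  induction m with
  | zero =>
    have hL : innerPairs q u k 0 = ∏ e ∈ Finset.range k,
        (1 - q ^ (1 + e + k) * (u * u)) / (1 - q ^ (2 + e + e) * (u * u)) := by
      refine Finset.prod_congr rfl fun e he => ?_
      have hf : (Finset.range k).filter (e < ·) = Finset.Ico (e + 1) k := by
        ext j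
        simp only [Finset.mem_filter, Finset.mem_range, Finset.mem_Ico]
        omega
      simp only [Nat.not_lt_zero, decide_false]
      rw [hf, prod_kernel_pos_pos (show e + 1 ≤ k from Finset.mem_range.1 he) fun j _ => h2 j]
      congr 3
      ring
    have hc : ∀ n, qPoch (q * u ^ 2) q n ≠ 0 := fun n => qPoch_ne_zero fun i _ h => h2 (i + 1)
      (by rw [← h]; ring)
    -- The telescoped rows leave the even exponents in the denominator; the parity splitting trades
    -- them for the base q².
    have h3 := qPoch_mul_qPoch_eq q (u ^ 2) k
    rw [qPoch_add] at h3
    have h4 : qPoch (q * u ^ 2 * q ^ k) q k =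
        ∏ e ∈ Finset.range k, (1 - q ^ (1 + e + k) * (u * u)) :=
      Finset.prod_congr rfl fun i _ => by ring
    have h0 := a2 0
    rw [pow_zero, one_mul] at h0
    rw [hL, innerCoeff, Finset.prod_div_distrib, ← h4]
    simp only [shiftCoeff, qPoch_zero, pow_zero, one_mul, add_zero, div_self h0, mul_zero, mul_one,
      div_one]
    rw [div_eq_div_iff (Finset.prod_ne_zero_iff.2 fun e _ => a2 _) (hc k), mul_comm, h3, pow_two u]
  | succ m ih =>
    have c1 : u - q ^ (m + 1) * u ≠ 0 := by
      simpa using sub_ne_zero.2 (pow_mul_ne hq hu h1 (Nat.succ_pos m))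
    have c2 := sub_ne_zero.2 (pow_mul_ne hq hu h1 (Nat.lt_succ_self m))
    have hne : q ^ m * (u - q ^ (m + 1) * u) / (q ^ m * u - q ^ (m + 1) * u) *
      ((1 - q ^ (1 + m + k) * (u * u)) / (1 - q ^ (1 + m + (m + 1)) * (u * u))) ≠ 0 :=
      mul_ne_zero (div_ne_zero (mul_ne_zero (pow_ne_zero _ hq) c1) c2)
        (div_ne_zero (a2 _) (a2 _))
    refine mul_right_cancel₀ hne ?_
    rw [innerPairs_succ hq hu h1 h2 (by omega), innerCoeff_succ hq hu h1 h2, ih (by omega)]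

end blocks

/-! ### The two sides, and sign sums over a union of blocks -/

/-- The left-hand side of the reduction formula. -/
def signSide {K : Type*} [Field K] {n s : ℕ} (q : K) (x : Fin n → K) (z : Fin s → K)
    (k : Fin s → ℕ) : K :=
  ∑ σ : Fin n → ℤˣ,
    (∏ i,
      ((1 - q * x i ^ (2 * (σ i : ℤ))) / (1 - x i ^ (2 * (σ i : ℤ))) *
        ∏ l, (1 - q ^ k l * z l * x i ^ (-(σ i : ℤ))) / (1 - z l * x i ^ (-(σ i : ℤ))))) *
    ∏ i, ∏ j ∈ Finset.Ioi i,
      (1 - q * (x i ^ (σ i : ℤ) * x j ^ (σ j : ℤ))) /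
        (1 - x i ^ (σ i : ℤ) * x j ^ (σ j : ℤ))

/-- The right-hand side of the reduction formula. -/
def boxSide {K : Type*} [Field K] {n s : ℕ} (q : K) (x : Fin n → K) (z : Fin s → K)
    (k : Fin s → ℕ) : K :=
  q ^ ((n : ℤ) * ((∑ l, k l : ℕ) : ℤ) - ((∑ l, k l).choose 2 : ℤ)) *
    qPochInt (-q) q ((n : ℤ) - ((∑ l, k l : ℕ) : ℤ)) *
    (∏ a, ∏ b ∈ Finset.Ioi a,
      qPoch (q ^ (k b + 1) * (z a * z b)) q (k a) / qPoch (q * (z a * z b)) q (k a)) *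
    (∏ a, qPoch (q * z a ^ 2) (q ^ 2) (k a) / qPoch (q * z a ^ 2) q (k a)) *
    ∑ m ∈ Finset.Iic k,
      (-1) ^ (∑ l, m l) * coeffC q k z m *
        q ^ ((((∑ l, k l : ℕ) : ℤ) - (n : ℤ)) * ((∑ l, m l : ℕ) : ℤ)) *
        ∏ i, ∏ l,
          (qPoch (q * (x i * z l)) q (m l) / qPoch (x i * z l) q (m l)) *
          (qPoch (q * (z l / x i)) q (m l) / qPoch (z l / x i) q (m l))

section blockSet

variable {s : ℕ}

/-- The disjoint union of blocks of sizes `k l`. -/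
def blockSet (k : Fin s → ℕ) : Finset (Fin s ×ₗ ℕ) :=
  (Finset.univ.sigma fun l => Finset.range (k l)).map
    ⟨fun p => toLex (p.1, p.2), fun p p' h => by
      obtain ⟨l, e⟩ := p
      obtain ⟨l', e'⟩ := p'
      have h := toLex.injective h
      simp only [Prod.mk.injEq] at h
      obtain ⟨rfl, rfl⟩ := h
      rfl⟩

theorem mem_blockSet {k : Fin s → ℕ} {l : Fin s} {e : ℕ} :
    toLex (l, e) ∈ blockSet k ↔ e < k l := by
  simp only [blockSet, Finset.mem_map, Finset.mem_sigma, Finset.mem_univ, true_and,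
    Finset.mem_range]
  constructor
  · rintro ⟨⟨l', e'⟩, h1, h2⟩
    have h := toLex.injective h2
    simp only [Prod.mk.injEq] at h
    obtain ⟨rfl, rfl⟩ := h
    exact h1
  · exact fun h => ⟨⟨l, e⟩, h, rfl⟩

theorem prod_blockSet {M : Type*} [CommMonoid M] (k : Fin s → ℕ) (f : Fin s ×ₗ ℕ → M) :
    ∏ p ∈ blockSet k, f p = ∏ l, ∏ e ∈ Finset.range (k l), f (toLex (l, e)) := by
  rw [blockSet, Finset.prod_map, Finset.prod_sigma]
  rfl

theorem card_blockSet (k : Fin s → ℕ) : (blockSet k).card = ∑ l, k l := by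
  simp [blockSet]

/-- A lexicographic inequality either compares blocks, with arbitrary exponents, or compares
exponents in one block. -/
theorem prod_lt_blockSet {M : Type*} [CommMonoid M] (k : Fin s → ℕ)
    (f : Fin s ×ₗ ℕ → Fin s ×ₗ ℕ → M) :
    ∏ p ∈ blockSet k, ∏ p' ∈ blockSet k with p < p', f p p' =
      (∏ a, ∏ b ∈ Finset.Ioi a, ∏ e ∈ Finset.range (k a), ∏ e' ∈ Finset.range (k b),
        f (toLex (a, e)) (toLex (b, e'))) *
      ∏ a, ∏ e ∈ Finset.range (k a), ∏ e' ∈ Finset.range (k a) with e < e',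
        f (toLex (a, e)) (toLex (a, e')) := by
  rw [prod_blockSet, ← Finset.prod_mul_distrib]
  refine Finset.prod_congr rfl fun a _ => ?_
  rw [Finset.prod_comm, ← Finset.prod_mul_distrib]
  refine Finset.prod_congr rfl fun e _ => ?_
  rw [Finset.prod_filter, prod_blockSet, ← Finset.filter_lt_eq_Ioi, Finset.prod_filter]
  have h : ∀ b, ∏ e' ∈ Finset.range (k b),
      (if toLex (a, e) < toLex (b, e') then f (toLex (a, e)) (toLex (b, e')) else 1) =
      (if a < b then ∏ e' ∈ Finset.range (k b), f (toLex (a, e)) (toLex (b, e')) else 1) *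
      (if b = a then ∏ e' ∈ Finset.range (k b) with e < e',
        f (toLex (a, e)) (toLex (b, e')) else 1) := by
    intro b
    rcases lt_trichotomy a b with h | h | h
    · simp [Prod.Lex.toLex_lt_toLex, h, h.ne, h.ne']
    · subst h
      simp [Prod.Lex.toLex_lt_toLex, Finset.prod_filter]
    · simp [Prod.Lex.toLex_lt_toLex, h.not_gt, h.ne, h.ne']
  rw [Finset.prod_congr rfl fun b _ => h b, Finset.prod_mul_distrib]
  congr 1
  simp

theorem mem_blockSet_iff {k : Fin s → ℕ} {p : Fin s ×ₗ ℕ} :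
    p ∈ blockSet k ↔ (ofLex p).2 < k (ofLex p).1 :=
  mem_blockSet (l := (ofLex p).1) (e := (ofLex p).2)

theorem blockSet_injective : Function.Injective (blockSet (s := s)) := by
  intro m m' h
  funext l
  have h1 : ∀ e, e < m l ↔ e < m' l := fun e => by
    rw [← mem_blockSet, h, mem_blockSet]
  have h2 := h1 (m l)
  have h3 := h1 (m' l)
  omega

theorem exists_eq_blockSet {k : Fin s → ℕ} {S : Finset (Fin s ×ₗ ℕ)} (hS : S ⊆ blockSet k)
    (h : ∀ l e, toLex (l, e + 1) ∈ S → toLex (l, e) ∈ S) :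
    ∃ m ≤ k, blockSet m = S := by
  classical
  have hex : ∀ l, ∃ e, toLex (l, e) ∉ S := fun l => ⟨k l, fun h1 => by
    have := mem_blockSet.1 (hS h1)
    omega⟩
  -- The length in block `l` is the first exponent missing from `S`.
  refine ⟨fun l => Nat.find (hex l), fun l => Nat.find_min' _ fun h1 => by
    have := mem_blockSet.1 (hS h1)
    omega, ?_⟩
  ext p
  rw [mem_blockSet_iff]
  obtain ⟨⟨l, e⟩, rfl⟩ := toLex.surjective p
  change e < Nat.find (hex l) ↔ _
  constructor
  · intro h1
    by_contra h2
    exact absurd (Nat.find_min' (hex l) h2) (not_le.2 h1)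
  · intro h1
    by_contra h2
    have h3 : ∀ d, toLex (l, Nat.find (hex l) + d) ∉ S := by
      intro d
      induction d with
      | zero => exact Nat.find_spec (hex l)
      | succ d ih => exact fun h4 => ih (h l _ h4)
    obtain ⟨d, hd⟩ := Nat.exists_eq_add_of_le (not_lt.1 h2)
    exact h3 d (hd ▸ h1)

/-- A set of negative signs that is not an initial segment of every block contains some `e + 1`
without `e`, and that pair has weight zero. -/
theorem signSum_blockSet {K : Type*} [Field K] (k : Fin s → ℕ) (A : Fin s ×ₗ ℕ → Bool → K)
    (G : Fin s ×ₗ ℕ → Bool → Fin s ×ₗ ℕ → Bool → K)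
    (hG : ∀ l e, G (toLex (l, e)) false (toLex (l, e + 1)) true = 0) :
    signSum (blockSet k) A G = ∑ m ∈ Finset.Iic k,
      (∏ p ∈ blockSet k, A p (decide (p ∈ blockSet m))) *
      ∏ p ∈ blockSet k, ∏ p' ∈ blockSet k with p < p',
        G p (decide (p ∈ blockSet m)) p' (decide (p' ∈ blockSet m)) := by
  classical
  rw [signSum, ← Finset.sum_image (s := Finset.Iic k) (g := blockSet)
    (f := fun S => (∏ p ∈ blockSet k, A p (decide (p ∈ S))) *
      ∏ p ∈ blockSet k, ∏ p' ∈ blockSet k with p < p', G p (decide (p ∈ S)) p' (decide (p' ∈ S)))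
    blockSet_injective.injOn]
  refine (Finset.sum_subset ?_ ?_).symm
  · intro S hS
    obtain ⟨m, hm, rfl⟩ := Finset.mem_image.1 hS
    refine Finset.mem_powerset.2 fun p hp => ?_
    rw [mem_blockSet_iff] at hp ⊢
    exact hp.trans_le (Finset.mem_Iic.1 hm _)
  · intro S hS hS'
    rw [Finset.mem_powerset] at hS
    have : ¬ ∀ l e, toLex (l, e + 1) ∈ S → toLex (l, e) ∈ S := fun h => hS' (by
      obtain ⟨m, hm, h1⟩ := exists_eq_blockSet hS h
      exact Finset.mem_image.2 ⟨m, Finset.mem_Iic.2 hm, h1⟩)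
    push Not at this
    obtain ⟨l, e, h1, h2⟩ := this
    have h3 := hS h1
    have h4 : toLex (l, e) ∈ blockSet k := mem_blockSet.2 (by
      have := mem_blockSet.1 h3
      omega)
    have h5 : toLex (l, e) < toLex (l, e + 1) := by simp [Prod.Lex.toLex_lt_toLex]
    refine mul_eq_zero_of_right _ (Finset.prod_eq_zero h4
      (Finset.prod_eq_zero (Finset.mem_filter.2 ⟨h3, h5⟩) ?_))
    rw [decide_eq_true h1, decide_eq_false h2, hG]

end blockSet

theorem signSum_univ {K : Type*} [Field K] {n : ℕ} (A : Fin n → Bool → K)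
    (G : Fin n → Bool → Fin n → Bool → K) :
    signSum Finset.univ A G = ∑ σ : Fin n → ℤˣ, (∏ i, A i (decide (σ i = -1))) *
      ∏ i, ∏ j ∈ Finset.Ioi i, G i (decide (σ i = -1)) j (decide (σ j = -1)) := by
  rw [signSum]
  refine Finset.sum_nbij' (fun S i => if i ∈ S then -1 else 1)
    (fun σ => Finset.univ.filter fun i => σ i = -1) (by simp) (by simp) ?_ ?_ ?_
  · intro S _
    ext i
    by_cases h : i ∈ S <;> simp [h]
  · intro σ _
    funext i
    rcases Int.units_eq_one_or (σ i) with h | h <;> simp [h]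
  · intro S _
    have : ∀ i, decide ((if i ∈ S then (-1 : ℤˣ) else 1) = -1) = decide (i ∈ S) := by
      intro i
      by_cases h : i ∈ S <;> simp [h]
    simp only [this, Finset.filter_lt_eq_Ioi]

theorem signPow_decide {K : Type*} [Field K] (x : K) (u : ℤˣ) :
    signPow x (decide (u = -1)) = x ^ (u : ℤ) := by
  rcases Int.units_eq_one_or u with rfl | rfl <;> simp [signPow]

theorem prod_prod_eq_diag_mul {M ι : Type*} [CommMonoid M] [Fintype ι] [LinearOrder ι]
    [LocallyFiniteOrderTop ι] [LocallyFiniteOrderBot ι] (F : ι → ι → M) :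
    ∏ a, ∏ b, F a b = (∏ a, F a a) * ∏ a, ∏ b ∈ Finset.Ioi a, (F a b * F b a) := by
  rw [Finset.prod_congr rfl fun a _ => Finset.prod_congr rfl fun b _ => mul_comm (F a b) (F b a),
    Finset.prod_prod_Ioi_mul_eq_prod_prod_off_diag (fun b a => F b a), Finset.prod_comm,
    ← Finset.prod_mul_distrib]
  refine Finset.prod_congr rfl fun a _ => ?_
  rw [← Finset.prod_compl_mul_prod {a}, Finset.prod_singleton, mul_comm]

/-! ### The theorem for generic parameters -/

section generic

variable {K : Type*} [Field K] {n s : ℕ} {q : K} {x : Fin n → K} {z : Fin s → K}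

/-- The geometric progressions with initial terms `z l`. -/
def blockVar (q : K) (z : Fin s → K) (p : Fin s ×ₗ ℕ) : K := q ^ (ofLex p).2 * z (ofLex p).1

/-- Along a block the numerator of each factor is the denominator of the next, so the
multiplicity-one weights telescope to those with q^(k_l). -/
theorem signSide_eq_sumX (g : Generic q x (blockVar q z)) (k : Fin s → ℕ) :
    signSide q x z k = sumX q x (blockVar q z) Finset.univ (blockSet k) := by
  rw [sumX, signSum_univ, signSide]
  refine Finset.sum_congr rfl fun σ _ => ?_
  congr 1
  · refine Finset.prod_congr rfl fun i _ => ?_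
    rw [weightX, signPow_not, signPow_decide, mul_comm (2 : ℤ), zpow_mul, zpow_neg, prod_blockSet,
      zpow_ofNat]
    congr 1
    refine Finset.prod_congr rfl fun l _ => ?_
    have h := prod_Ico_telescope (F := fun e => 1 - q ^ e * z l * (x i ^ (σ i : ℤ))⁻¹)
      (f := fun e => (1 - q * blockVar q z (toLex (l, e)) * (x i ^ (σ i : ℤ))⁻¹) /
        (1 - blockVar q z (toLex (l, e)) * (x i ^ (σ i : ℤ))⁻¹)) (Nat.zero_le (k l)) ?_ ?_
    · rw [Finset.range_eq_Ico, h, pow_zero, one_mul]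
    · intro e _ _ h0
      refine g.ne_signPow (toLex (l, e)) i (decide (σ i = -1)) ?_
      rw [signPow_decide]
      exact (mul_inv_eq_one₀ (zpow_ne_zero _ (g.x_ne i))).1 (sub_eq_zero.1 h0).symm
    · intro e _ _
      simp only [blockVar, ofLex_toLex, pow_succ']
      ring
  · refine Finset.prod_congr rfl fun i _ => Finset.prod_congr rfl fun j _ => ?_
    rw [kernX, pairKernel, signPow_decide, signPow_decide]

/-- The q in the denominator of `crossFactor` produces the part -n|m| of the exponent (|k| - n)|m|;
the part |k||m| comes from `prod_kernZ_blockSet`. -/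
theorem prod_weightZ_blockSet {k m : Fin s → ℕ} (hm : m ≤ k) :
    ∏ p ∈ blockSet k, weightZ q x (blockVar q z) Finset.univ p (decide (p ∈ blockSet m)) =
      q ^ (-((n : ℤ) * ((∑ l, m l : ℕ) : ℤ))) * ∏ i, ∏ l,
        (qPoch (q * (x i * z l)) q (m l) / qPoch (x i * z l) q (m l)) *
          (qPoch (q * (z l / x i)) q (m l) / qPoch (z l / x i) q (m l)) := by
  have h1 : ∀ l, ∏ e ∈ Finset.range (k l), weightZ q x (blockVar q z) Finset.univ (toLex (l, e))
      (decide (toLex (l, e) ∈ blockSet m)) =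
      ∏ i, ((q⁻¹) ^ m l * ((qPoch (q * (x i * z l)) q (m l) / qPoch (x i * z l) q (m l)) *
          (qPoch (q * (z l / x i)) q (m l) / qPoch (z l / x i) q (m l)))) := by
    intro l
    rw [prod_range_split (hm l)
      (g := fun e => ∏ i, crossFactor q (x i) (blockVar q z (toLex (l, e)))) (h := fun _ => 1)
      (fun e he => by rw [weightZ, decide_eq_true (mem_blockSet.2 he), cond_true])
      (fun e he => by
        rw [weightZ, decide_eq_false (fun h => absurd (mem_blockSet.1 h) (not_lt.2 he)),
          cond_false]),
      Finset.prod_const_one, mul_one, Finset.prod_comm]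
    refine Finset.prod_congr rfl fun i _ => ?_
    simp only [qPoch]
    rw [← Finset.prod_div_distrib, ← Finset.prod_div_distrib, ← Finset.prod_mul_distrib,
      ← Finset.card_range (m l), ← Finset.prod_const, Finset.card_range, ← Finset.prod_mul_distrib]
    refine Finset.prod_congr rfl fun e _ => ?_
    simp only [crossFactor, blockVar, ofLex_toLex]
    rw [div_mul_div_comm, ← one_div, div_mul_div_comm, one_mul]
    congr 1 <;> ring
  rw [prod_blockSet, Finset.prod_congr rfl fun l _ => h1 l, Finset.prod_comm]
  simp only [Finset.prod_mul_distrib, Finset.prod_pow_eq_pow_sum]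
  rw [Finset.sum_const, Finset.card_univ, Fintype.card_fin, smul_eq_mul, inv_pow, ← zpow_natCast,
    ← zpow_neg]
  push_cast
  rfl

/-- Collects `crossCoeff` over pairs of blocks and `innerCoeff` over single blocks. `h0` supplies
the exponent 0, as genericity excludes q^j z_a z_b = 1 only for j ≥ 1. -/
theorem prod_kernZ_blockSet (g : Generic q x (blockVar q z)) (h0 : ∀ a b, z a * z b ≠ 1)
    {k m : Fin s → ℕ} (hm : m ≤ k) :
    ∏ p ∈ blockSet k, ∏ p' ∈ blockSet k with p < p', kernZ q (blockVar q z) p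
      (decide (p ∈ blockSet m)) p' (decide (p' ∈ blockSet m)) =
    (∏ a, ∏ b ∈ Finset.Ioi a,
      qPoch (q ^ (k b + 1) * (z a * z b)) q (k a) / qPoch (q * (z a * z b)) q (k a)) *
    (∏ a, qPoch (q * z a ^ 2) (q ^ 2) (k a) / qPoch (q * z a ^ 2) q (k a)) *
    ((-1) ^ (∑ l, m l) * coeffC q k z m * q ^ ((∑ l, k l) * (∑ l, m l))) := by
  have hq := g.q_ne
  have hz : ∀ l, z l ≠ 0 := fun l h => g.z_ne (toLex (l, 0)) (by simp [blockVar, h])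
  have hzz : ∀ a b j, q ^ j * (z a * z b) ≠ 1 := by
    intro a b j
    cases j with
    | zero => simpa using h0 a b
    | succ j =>
      have := g.qzz_mul (toLex (a, j)) (toLex (b, 0))
      simp only [blockVar, ofLex_toLex, pow_zero, one_mul] at this
      exact fun h => this (by rw [← h]; ring)
  have hzne : ∀ a b, a ≠ b → ∀ e f, q ^ e * z a ≠ q ^ f * z b := fun a b hab e f =>
    g.zz_ne (toLex (a, e)) (toLex (b, f)) fun h => hab (by
      have := toLex.injective h
      simp only [Prod.mk.injEq] at this
      exact this.1)
  -- A block has to be given: roots of unity are excluded only through the distinctness of its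
  -- elements.
  have hq1 : ∀ _ : Fin s, ∀ j, 1 ≤ j → q ^ j ≠ 1 := fun a j hj h => by
    refine g.zz_ne (toLex (a, j)) (toLex (a, 0)) (fun h1 => ?_) (by simp [blockVar, h])
    have := toLex.injective h1
    simp only [Prod.mk.injEq] at this
    omega
  have hdec : ∀ (l : Fin s) (e : ℕ), decide (toLex (l, e) ∈ blockSet m) = decide (e < m l) :=
    fun l e => by rw [decide_eq_decide, mem_blockSet]
  rw [prod_lt_blockSet]
  simp only [hdec]
  have hc : ∀ a, ∀ b ∈ Finset.Ioi a, ∏ e ∈ Finset.range (k a), ∏ f ∈ Finset.range (k b),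
      kernZ q (blockVar q z) (toLex (a, e)) (decide (e < m a)) (toLex (b, f)) (decide (f < m b)) =
      crossCoeff q (z a) (z b) (k a) (k b) (m a) (m b) := fun a b hb =>
    crossPairs_eq hq (hz a) (hz b) (hzne a b (Finset.mem_Ioi.1 hb).ne) (hzz a b) (hm a) (hm b)
  have hi : ∀ a, ∏ e ∈ Finset.range (k a), ∏ f ∈ Finset.range (k a) with e < f,
      kernZ q (blockVar q z) (toLex (a, e)) (decide (e < m a)) (toLex (a, f)) (decide (f < m a)) =
      innerCoeff q (z a) (k a) (m a) := fun a =>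
    innerPairs_eq hq (hz a) (hq1 a) (hzz a a) (hm a)
  rw [Finset.prod_congr rfl fun a _ => Finset.prod_congr rfl fun b hb => hc a b hb,
    Finset.prod_congr rfl fun a _ => hi a]
  -- The exponent |k||m| is the sum of k_b m_a over all ordered pairs; the diagonal belongs to
  -- `innerCoeff`, the rest to `crossCoeff`.
  have hpow : q ^ ((∑ l, k l) * (∑ l, m l)) = (∏ a, q ^ (k a * m a)) *
      ∏ a, ∏ b ∈ Finset.Ioi a, q ^ (k b * m a + k a * m b) := by
    have := prod_prod_eq_diag_mul (fun a b => q ^ (k b * m a))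
    simp only [← pow_add] at this
    rw [← this, Finset.sum_mul_sum, Finset.sum_comm, ← Finset.prod_pow_eq_pow_sum]
    refine Finset.prod_congr rfl fun a _ => ?_
    rw [Finset.prod_pow_eq_pow_sum]
  have hIci : ∀ f : Fin s → Fin s → K,
      ∏ a, ∏ b ∈ Finset.Ici a, f a b = (∏ a, f a a) * ∏ a, ∏ b ∈ Finset.Ioi a, f a b := by
    intro f
    rw [← Finset.prod_mul_distrib]
    exact Finset.prod_congr rfl fun a _ => (Finset.mul_prod_Ioi_eq_prod_Ici _).symm
  have hshift := prod_prod_eq_diag_mul (fun a b => shiftCoeff q (z a) (z b) (k b) (m a))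
  have hcoeff : coeffC q k z m =
      (∏ a, ∏ b ∈ Finset.Ioi a, (q ^ m a * z a - q ^ m b * z b) / (z a - z b)) *
      (∏ a, ∏ b ∈ Finset.Ici a, (1 - q ^ (m a + m b) * z a * z b) / (1 - z a * z b)) *
      ∏ a, ∏ b, shiftCoeff q (z a) (z b) (k b) (m a) := rfl
  rw [hcoeff, hshift, hIci, hpow, ← Finset.prod_pow_eq_pow_sum]
  simp only [crossCoeff, innerCoeff, Finset.prod_mul_distrib]
  ring

theorem signSide_eq_boxSide (g : Generic q x (blockVar q z)) (h0 : ∀ a b, z a * z b ≠ 1)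
    {k : Fin s → ℕ} : signSide q x z k = boxSide q x z k := by
  have hq := g.q_ne
  have hG : ∀ (l : Fin s) (e : ℕ), kernZ q (blockVar q z) (toLex (l, e)) false
      (toLex (l, e + 1)) true = 0 := by
    intro l e
    have h1 := g.z_ne (toLex (l, e + 1))
    simp only [kernZ, pairKernel, dualArg]
    have : q * (blockVar q z (toLex (l, e)) / blockVar q z (toLex (l, e + 1))) = 1 := by
      rw [mul_div_assoc', div_eq_one_iff_eq h1]
      simp only [blockVar, ofLex_toLex]
      ring
    rw [this, sub_self, zero_div]
  rw [signSide_eq_sumX g, sumX_eq_sumZ g, card_blockSet, Finset.card_univ, Fintype.card_fin,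
    sumZ, signSum_blockSet k _ _ hG, boxSide, dualityConst, Finset.mul_sum, Finset.mul_sum]
  refine Finset.sum_congr rfl fun m hm => ?_
  have hm := Finset.mem_Iic.1 hm
  have e : q ^ ((((∑ l, k l : ℕ) : ℤ) - (n : ℤ)) * ((∑ l, m l : ℕ) : ℤ)) =
      q ^ (-((n : ℤ) * ((∑ l, m l : ℕ) : ℤ))) * q ^ ((∑ l, k l) * (∑ l, m l)) := by
    rw [← zpow_natCast, ← zpow_add₀ hq]
    congr 1
    push_cast
    ring
  rw [prod_weightZ_blockSet hm, prod_kernZ_blockSet g h0 hm, e]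
  ring

end generic

/-! ### Values of fractions under a ring homomorphism -/

/-- `k` is the value of the fraction `f` under the ring homomorphism `φ`, which does not kill the
denominator of `f`. -/
def HasValue {A F K : Type*} [CommRing A] [Field F] [Algebra A F] [Field K] (φ : A →+* K)
    (f : F) (k : K) : Prop :=
  ∃ a b : A, φ b ≠ 0 ∧ f = algebraMap A F a / algebraMap A F b ∧ k = φ a / φ b

namespace HasValue

variable {A F K : Type*} [CommRing A] [Field F] [Algebra A F]
  [Field K] {φ : A →+* K}

theorem of_map (a : A) : HasValue φ (algebraMap A F a) (φ a) := ⟨a, 1, by simp, by simp, by simp⟩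

theorem one : HasValue φ (1 : F) 1 := by simpa using of_map (F := F) (φ := φ) 1

theorem zero : HasValue φ (0 : F) 0 := by simpa using of_map (F := F) (φ := φ) 0

theorem mul {f f' : F} {k k' : K} (h : HasValue φ f k) (h' : HasValue φ f' k') :
    HasValue φ (f * f') (k * k') := by
  obtain ⟨a, b, hb, rfl, rfl⟩ := h
  obtain ⟨a', b', hb', rfl, rfl⟩ := h'
  exact ⟨a * a', b * b', by simp [hb, hb'], by simp [div_mul_div_comm],
    by simp [div_mul_div_comm]⟩

theorem neg {f : F} {k : K} (h : HasValue φ f k) : HasValue φ (-f) (-k) := by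
  obtain ⟨a, b, hb, rfl, rfl⟩ := h
  exact ⟨-a, b, hb, by simp [neg_div], by simp [neg_div]⟩

theorem inv {f : F} {k : K} (h : HasValue φ f k) (hk : k ≠ 0) : HasValue φ f⁻¹ k⁻¹ := by
  obtain ⟨a, b, hb, rfl, rfl⟩ := h
  exact ⟨b, a, fun h0 => hk (by rw [h0, zero_div]), by rw [inv_div], by rw [inv_div]⟩

theorem div {f f' : F} {k k' : K} (h : HasValue φ f k) (h' : HasValue φ f' k')
    (hk : k' ≠ 0) : HasValue φ (f / f') (k / k') := by
  rw [div_eq_mul_inv, div_eq_mul_inv]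
  exact h.mul (h'.inv hk)

theorem pow {f : F} {k : K} (h : HasValue φ f k) (j : ℕ) : HasValue φ (f ^ j) (k ^ j) := by
  induction j with
  | zero => simpa using one
  | succ j ih =>
    rw [pow_succ, pow_succ]
    exact ih.mul h

theorem zpow {f : F} {k : K} (h : HasValue φ f k) (hk : k ≠ 0) (j : ℤ) :
    HasValue φ (f ^ j) (k ^ j) := by
  cases j with
  | ofNat j => simpa using h.pow j
  | negSucc j =>
    rw [zpow_negSucc, zpow_negSucc]
    exact (h.pow _).inv (pow_ne_zero _ hk)

theorem prod {ι : Type*} {s : Finset ι} {f : ι → F} {k : ι → K}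
    (h : ∀ i ∈ s, HasValue φ (f i) (k i)) :
    HasValue φ (∏ i ∈ s, f i) (∏ i ∈ s, k i) := by
  classical
  induction s using Finset.induction_on with
  | empty => simpa using one
  | insert a s ha ih =>
    rw [Finset.prod_insert ha, Finset.prod_insert ha]
    exact (h a (by simp)).mul (ih fun i hi => h i (by simp [hi]))

variable [IsFractionRing A F]

theorem algebraMap_ne_zero {b : A} (h : φ b ≠ 0) : algebraMap A F b ≠ 0 := fun h0 =>
  h (by rw [(map_eq_zero_iff _ (IsFractionRing.injective A F)).1 h0, map_zero])

/-- Two representations of `f` agree after cross-multiplication already in `A`, and `φ` preserves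
that equation. -/
theorem unique {f : F} {k k' : K} (h : HasValue φ f k) (h' : HasValue φ f k') : k = k' := by
  obtain ⟨a, b, hb, hf, rfl⟩ := h
  obtain ⟨a', b', hb', hf', rfl⟩ := h'
  rw [hf, div_eq_div_iff (algebraMap_ne_zero hb) (algebraMap_ne_zero hb'), ← map_mul,
    ← map_mul] at hf'
  rw [div_eq_div_iff hb hb', ← map_mul, ← map_mul, IsFractionRing.injective A F hf']

theorem add {f f' : F} {k k' : K} (h : HasValue φ f k) (h' : HasValue φ f' k') :
    HasValue φ (f + f') (k + k') := by
  obtain ⟨a, b, hb, rfl, rfl⟩ := h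
  obtain ⟨a', b', hb', rfl, rfl⟩ := h'
  refine ⟨a * b' + b * a', b * b', by simp [hb, hb'], ?_, ?_⟩
  · rw [div_add_div _ _ (algebraMap_ne_zero hb) (algebraMap_ne_zero hb')]; simp
  · rw [div_add_div _ _ hb hb']; simp

theorem sub {f f' : F} {k k' : K} (h : HasValue φ f k) (h' : HasValue φ f' k') :
    HasValue φ (f - f') (k - k') := by
  rw [sub_eq_add_neg, sub_eq_add_neg]
  exact h.add h'.neg

theorem sum {ι : Type*} {s : Finset ι} {f : ι → F} {k : ι → K}
    (h : ∀ i ∈ s, HasValue φ (f i) (k i)) :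
    HasValue φ (∑ i ∈ s, f i) (∑ i ∈ s, k i) := by
  classical
  induction s using Finset.induction_on with
  | empty => simpa using zero
  | insert a s ha ih =>
    rw [Finset.sum_insert ha, Finset.sum_insert ha]
    exact (h a (by simp)).add (ih fun i hi => h i (by simp [hi]))

theorem qPoch {a q : F} {a' q' : K} (ha : HasValue φ a a') (hq : HasValue φ q q') (j : ℕ) :
    HasValue φ (qPoch a q j) (qPoch a' q' j) :=
  prod fun i _ => one.sub (ha.mul (hq.pow i))

theorem qPochInt {q : F} {q' : K} (hq : HasValue φ q q') (hq0 : q' ≠ 0) (N : ℤ)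
    (h : ∀ e : ℕ, N + e < 0 → q' ^ e ≠ -1) :
    HasValue φ (qPochInt (-q) q N) (qPochInt (-q') q' N) := by
  cases N with
  | ofNat N => exact qPoch hq.neg hq N
  | negSucc M =>
    refine (qPoch (hq.neg.mul (hq.zpow hq0 _)) hq (M + 1)).inv (qPoch_ne_zero fun i hi h0 => ?_)
    -- The inverted factor of index `i` is 1 + q^(i - M), which is zero exactly when q^(M - i) = -1.
    refine h (M - i) (by rw [Int.negSucc_eq]; omega) ?_
    have h1 : q' * q' ^ (-((M : ℤ) + 1)) * q' ^ i * q' ^ (M - i) = 1 := by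
      rw [mul_assoc, ← pow_add, Nat.add_sub_of_le (by omega), ← zpow_natCast, ← zpow_one_add₀ hq0,
        ← zpow_add₀ hq0]
      simp
    linear_combination -h1 - q' ^ (M - i) * h0

end HasValue

/-! ### Nonvanishing of the denominators after specialisation -/

section transport

open HasValue

variable {A F K : Type*} [CommRing A] [Field F] [Algebra A F] [IsFractionRing A F]
  [Field K] {φ : A →+* K} {n s : ℕ} {q : F} {x : Fin n → F} {z : Fin s → F}
  {q' : K} {x' : Fin n → K} {z' : Fin s → K}

theorem HasValue.signSide {k : Fin s → ℕ} (hq : HasValue φ q q')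
    (hx : ∀ i, HasValue φ (x i) (x' i)) (hz : ∀ l, HasValue φ (z l) (z' l))
    (hk : ∀ l, 0 < k l) (hx0 : ∀ i, x' i ≠ 0) (hxsq : ∀ i, x' i ^ 2 ≠ 1)
    (hxx : ∀ i j, i < j → x' i * x' j ≠ 1 ∧ x' i ≠ x' j)
    (hzx : ∀ l i, ∀ e < k l, q' ^ e * (z' l * x' i) ≠ 1 ∧ q' ^ e * (z' l / x' i) ≠ 1) :
    HasValue φ (signSide q x z k) (signSide q' x' z' k) := by
  have hxu : ∀ i (u : ℤ), HasValue φ (x i ^ u) (x' i ^ u) := fun i u => (hx i).zpow (hx0 i) u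
  refine sum fun σ _ => mul (prod fun i _ => mul (div (one.sub (hq.mul (hxu i _)))
    (one.sub (hxu i _)) ?_) (prod fun l _ => div (one.sub (((hq.pow _).mul (hz l)).mul (hxu i _)))
    (one.sub ((hz l).mul (hxu i _))) ?_)) (prod fun i _ => prod fun j hj => div
    (one.sub (hq.mul ((hxu i _).mul (hxu j _)))) (one.sub ((hxu i _).mul (hxu j _))) ?_)
  · rw [sub_ne_zero]
    have := hxsq i
    rcases Int.units_eq_one_or (σ i) with h | h <;> rw [h]
    · exact fun h => this (by simpa using h.symm)
    · intro h
      apply this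
      have h1 : (x' i ^ 2)⁻¹ = 1 := by
        rw [← zpow_natCast, ← zpow_neg]
        exact h.symm
      exact inv_eq_one.1 h1
  · rw [sub_ne_zero]
    -- The denominators of this side need only the exponent 0, available since k_l is positive.
    obtain ⟨h1, h2⟩ := hzx l i 0 (hk l)
    rw [pow_zero, one_mul] at h1 h2
    rcases Int.units_eq_one_or (σ i) with h | h <;> rw [h]
    · simpa [div_eq_mul_inv] using h2.symm
    · simpa using h1.symm
  · rw [sub_ne_zero]
    obtain ⟨h1, h2⟩ := hxx i j (Finset.mem_Ioi.1 hj)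
    have h3 := hx0 i
    have h4 := hx0 j
    rcases Int.units_eq_one_or (σ i) with h | h <;> rcases Int.units_eq_one_or (σ j) with h' | h' <;>
      rw [h, h'] <;> simp only [Units.val_one, Units.val_neg, zpow_one, zpow_neg]
    · exact h1.symm
    · exact fun h0 => h2 ((mul_inv_eq_one₀ h4).1 h0.symm)
    · exact fun h0 => h2 ((inv_mul_eq_one₀ h3).1 h0.symm)
    · rw [← mul_inv]
      exact fun h0 => h1 (inv_eq_one.1 h0.symm)

theorem HasValue.coeffC {k m : Fin s → ℕ} (hm : m ≤ k) (hq : HasValue φ q q')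
    (hz : ∀ l, HasValue φ (z l) (z' l)) (hq0 : q' ≠ 0) (hz0 : ∀ l, z' l ≠ 0)
    (hzz : ∀ a b, ∀ e ≤ k a + k b, q' ^ e * (z' a * z' b) ≠ 1)
    (hzne : ∀ a b, a ≠ b → z' a ≠ z' b)
    (hzdiv : ∀ a b, ∀ e : ℕ, 1 ≤ e → e ≤ k a → q' ^ e * (z' a / z' b) ≠ 1) :
    HasValue φ (coeffC q k z m) (coeffC q' k z' m) := by
  have hdiv : ∀ a b, HasValue φ (z a / z b) (z' a / z' b) := fun a b =>
    (hz a).div (hz b) (hz0 b)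
  refine mul (mul (prod fun a _ => prod fun b hb => div (((hq.pow _).mul (hz a)).sub
    ((hq.pow _).mul (hz b))) ((hz a).sub (hz b)) ?_) (prod fun a _ => prod fun b _ => div
    (one.sub (((hq.pow _).mul (hz a)).mul (hz b))) (one.sub ((hz a).mul (hz b))) ?_))
    (prod fun a _ => prod fun b _ => mul (div (((hq.zpow hq0 _).mul (hdiv a b)).qPoch hq _)
    ((hq.mul (hdiv a b)).qPoch hq _) ?_) (div (((hz a).mul (hz b)).qPoch hq _)
    (((hq.pow _).mul ((hz a).mul (hz b))).qPoch hq _) ?_))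
  · exact sub_ne_zero.2 (hzne a b (Finset.mem_Ioi.1 hb).ne)
  · exact sub_ne_zero.2 fun h => hzz a b 0 (Nat.zero_le _) (by rw [← h]; simp)
  · refine qPoch_ne_zero fun i hi h => hzdiv a b (i + 1) (by omega) ?_ (by rw [← h]; ring)
    have : m a ≤ k a := hm a
    omega
  · refine qPoch_ne_zero fun i hi h => hzz a b (1 + k b + i) ?_ (by rw [← h]; ring)
    have : m a ≤ k a := hm a
    omega

theorem HasValue.boxSide {k : Fin s → ℕ} (hq : HasValue φ q q')
    (hx : ∀ i, HasValue φ (x i) (x' i)) (hz : ∀ l, HasValue φ (z l) (z' l))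
    (hq0 : q' ≠ 0) (hx0 : ∀ i, x' i ≠ 0) (hz0 : ∀ l, z' l ≠ 0)
    (hzx : ∀ l i, ∀ e < k l, q' ^ e * (z' l * x' i) ≠ 1 ∧ q' ^ e * (z' l / x' i) ≠ 1)
    (hzz : ∀ a b, ∀ e ≤ k a + k b, q' ^ e * (z' a * z' b) ≠ 1)
    (hzne : ∀ a b, a ≠ b → z' a ≠ z' b)
    (hzdiv : ∀ a b, ∀ e : ℕ, 1 ≤ e → e ≤ k a → q' ^ e * (z' a / z' b) ≠ 1)
    (hneg : ∀ e : ℕ, n + e < ∑ l, k l → q' ^ e ≠ -1) :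
    HasValue φ (boxSide q x z k) (boxSide q' x' z' k) := by
  have hzz' : ∀ a b, HasValue φ (z a * z b) (z' a * z' b) := fun a b => (hz a).mul (hz b)
  have hxz : ∀ i l, HasValue φ (x i * z l) (x' i * z' l) := fun i l => (hx i).mul (hz l)
  have hzx' : ∀ l i, HasValue φ (z l / x i) (z' l / x' i) := fun l i =>
    (hz l).div (hx i) (hx0 i)
  refine mul (mul (mul (mul (hq.zpow hq0 _) (hq.qPochInt hq0 _ fun e he => hneg e (by omega)))
    (prod fun a _ => prod fun b _ => div (((hq.pow _).mul (hzz' a b)).qPoch hq _)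
    ((hq.mul (hzz' a b)).qPoch hq _) ?_)) (prod fun a _ => div
    ((hq.mul ((hz a).pow 2)).qPoch (hq.pow 2) _) ((hq.mul ((hz a).pow 2)).qPoch hq _) ?_))
    (sum fun m hm => mul (mul (mul (one.neg.pow _)
    (HasValue.coeffC (Finset.mem_Iic.1 hm) hq hz hq0 hz0 hzz hzne hzdiv)) (hq.zpow hq0 _))
    (prod fun i _ => prod fun l _ => mul (div ((hq.mul (hxz i l)).qPoch hq _)
    ((hxz i l).qPoch hq _) ?_) (div ((hq.mul (hzx' l i)).qPoch hq _) ((hzx' l i).qPoch hq _) ?_)))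
  · exact qPoch_ne_zero fun i hi h => hzz a b (i + 1) (by omega) (by rw [← h]; ring)
  · exact qPoch_ne_zero fun i hi h => hzz a a (i + 1) (by omega) (by rw [← h]; ring)
  · exact qPoch_ne_zero fun e he h => (hzx l i e (he.trans_le (Finset.mem_Iic.1 hm l))).1
      (by rw [← h]; ring)
  · exact qPoch_ne_zero fun e he h => (hzx l i e (he.trans_le (Finset.mem_Iic.1 hm l))).2
      (by rw [← h]; ring)

end transport

/-! ### Genericity of the indeterminates -/

section indeterminates

variable {n s : ℕ}

/-- The ring of integer polynomials in the indeterminates `q`, `x` and `z`. -/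
abbrev ParamRing (n s : ℕ) : Type := MvPolynomial (Option (Fin n ⊕ Fin s)) ℤ

/-- The homomorphism that assigns values to the indeterminates. -/
noncomputable def paramHom {R : Type*} [CommRing R] (q : R) (x : Fin n → R) (z : Fin s → R) :
    ParamRing n s →+* R :=
  MvPolynomial.eval₂Hom (Int.castRingHom R) fun o => o.elim q (Sum.elim x z)

/-- The indeterminate `q`. -/
noncomputable def paramQ : ParamRing n s := MvPolynomial.X none

/-- The indeterminates `x`. -/
noncomputable def paramX (i : Fin n) : ParamRing n s := MvPolynomial.X (some (Sum.inl i))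

/-- The indeterminates `z`. -/
noncomputable def paramZ (l : Fin s) : ParamRing n s := MvPolynomial.X (some (Sum.inr l))

variable {R : Type*} [CommRing R] (q : R) (x : Fin n → R) (z : Fin s → R)

@[simp] theorem paramHom_paramQ : paramHom q x z paramQ = q := by simp [paramHom, paramQ]

@[simp] theorem paramHom_paramX (i : Fin n) : paramHom q x z (paramX i) = x i := by
  simp [paramHom, paramX]

@[simp] theorem paramHom_paramZ (l : Fin s) : paramHom q x z (paramZ l) = z l := by
  simp [paramHom, paramZ]

/-- An equation between fractions of polynomials holds for all integer values. -/
theorem paramHom_congr {a b : ParamRing n s}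
    (h : algebraMap (ParamRing n s) (FractionRing (ParamRing n s)) a = algebraMap _ _ b)
    (q : ℤ) (x : Fin n → ℤ) (z : Fin s → ℤ) : paramHom q x z a = paramHom q x z b := by
  rw [IsFractionRing.injective _ _ h]

/-- A coincidence would be an identity between integer polynomials and so would survive every
substitution of integers; for each one a substitution is given that breaks it. -/
theorem generic_param : Generic (algebraMap (ParamRing n s) (FractionRing (ParamRing n s)) paramQ)
    (fun i : Fin n => algebraMap (ParamRing n s) _ (paramX i)) (blockVar
      (algebraMap (ParamRing n s) _ paramQ)
      fun l => algebraMap (ParamRing n s) (FractionRing (ParamRing n s)) (paramZ l)) where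
  q_ne h := by
    rw [← map_zero (algebraMap (ParamRing n s) _)] at h
    simpa using paramHom_congr h 1 1 1
  q_pow j h := by
    rw [← map_one (algebraMap (ParamRing n s) _), ← map_neg, ← map_pow] at h
    have := paramHom_congr h 2 1 1
    simp only [map_pow, map_neg, map_one, paramHom_paramQ] at this
    have h2 : (0 : ℤ) < 2 ^ j := by positivity
    omega
  q_one h := by
    rw [← map_one (algebraMap (ParamRing n s) _)] at h
    simpa using paramHom_congr h 0 1 1
  x_ne i h := by
    rw [← map_zero (algebraMap (ParamRing n s) _)] at h
    simpa using paramHom_congr h 1 1 1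
  z_ne p h := by
    rw [blockVar, ← map_zero (algebraMap (ParamRing n s) _), ← map_pow, ← map_mul] at h
    simpa using paramHom_congr h 1 1 1
  xx_mul i j h := by
    rw [← map_one (algebraMap (ParamRing n s) _), ← map_mul] at h
    simpa using paramHom_congr h 1 0 1
  xx_ne i j hij h := by
    have := paramHom_congr h 1 (Pi.single i 1) 1
    simp [hij.symm] at this
  qxx_mul i j h := by
    rw [← map_one (algebraMap (ParamRing n s) _), ← map_mul, ← map_mul] at h
    simpa using paramHom_congr h 1 0 1
  qxx_ne i j h := by
    rw [← map_mul] at h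
    simpa using paramHom_congr h 0 1 1
  zz_ne p p' hp h := by
    simp only [blockVar, ← map_pow, ← map_mul] at h
    by_cases hl : (ofLex p).1 = (ofLex p').1
    · have := paramHom_congr h 2 1 1
      simp only [map_mul, map_pow, paramHom_paramQ, paramHom_paramZ, Pi.one_apply, mul_one] at this
      have he := Int.pow_right_injective (a := 2) (by decide) this
      exact hp (ofLex.injective (Prod.ext hl he))
    · have := paramHom_congr h 1 1 (Pi.single (ofLex p).1 1)
      simp [Ne.symm hl] at this
  qzz_mul p p' h := by
    simp only [blockVar, ← map_pow, ← map_mul] at h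
    rw [← map_one (algebraMap (ParamRing n s) _)] at h
    simpa using paramHom_congr h 1 1 0
  zx_mul p i h := by
    simp only [blockVar, ← map_pow, ← map_mul] at h
    rw [← map_one (algebraMap (ParamRing n s) _)] at h
    simpa using paramHom_congr h 1 1 0
  zx_ne p i h := by
    simp only [blockVar, ← map_pow, ← map_mul] at h
    simpa using paramHom_congr h 1 1 0
  qzx_mul p i h := by
    simp only [blockVar, ← map_pow, ← map_mul] at h
    rw [← map_one (algebraMap (ParamRing n s) _)] at h
    simpa using paramHom_congr h 1 1 0
  qzx_ne p i h := by
    simp only [blockVar, ← map_pow, ← map_mul] at h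
    simpa using paramHom_congr h 1 1 0

end indeterminates

theorem theorem10 {K : Type*} [Field K] (n s : ℕ)
    (q : K) (x : Fin n → K) (z : Fin s → K) (k : Fin s → ℕ)
    (hk : ∀ l, 0 < k l)
    (hq : q ≠ 0) (hx : ∀ i, x i ≠ 0) (hz : ∀ l, z l ≠ 0)
    (hxsq : ∀ i, x i ^ 2 ≠ 1)
    (hxx : ∀ i j, i < j → x i * x j ≠ 1 ∧ x i ≠ x j)
    (hzx : ∀ l i, ∀ e < k l, q ^ e * (z l * x i) ≠ 1 ∧ q ^ e * (z l / x i) ≠ 1)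
    (hzz : ∀ a b, ∀ e ≤ k a + k b, q ^ e * (z a * z b) ≠ 1)
    (hzne : ∀ a b, a ≠ b → z a ≠ z b)
    (hzdiv : ∀ a b, ∀ e : ℕ, 1 ≤ e → e ≤ k a → q ^ e * (z a / z b) ≠ 1)
    (hneg : ∀ e : ℕ, n + e < ∑ l, k l → q ^ e ≠ -1) :
    (∑ σ : Fin n → ℤˣ,
      (∏ i,
        ((1 - q * x i ^ (2 * (σ i : ℤ))) / (1 - x i ^ (2 * (σ i : ℤ))) *
          ∏ l, (1 - q ^ k l * z l * x i ^ (-(σ i : ℤ))) / (1 - z l * x i ^ (-(σ i : ℤ))))) *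
      ∏ i, ∏ j ∈ Finset.Ioi i,
        (1 - q * (x i ^ (σ i : ℤ) * x j ^ (σ j : ℤ))) /
          (1 - x i ^ (σ i : ℤ) * x j ^ (σ j : ℤ)))
    = q ^ ((n : ℤ) * ((∑ l, k l : ℕ) : ℤ) - ((∑ l, k l).choose 2 : ℤ)) *
      qPochInt (-q) q ((n : ℤ) - ((∑ l, k l : ℕ) : ℤ)) *
      (∏ a, ∏ b ∈ Finset.Ioi a,
        qPoch (q ^ (k b + 1) * (z a * z b)) q (k a) / qPoch (q * (z a * z b)) q (k a)) *
      (∏ a, qPoch (q * z a ^ 2) (q ^ 2) (k a) / qPoch (q * z a ^ 2) q (k a)) *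
      ∑ m ∈ Finset.Iic k,
        (-1) ^ (∑ l, m l) * coeffC q k z m *
          q ^ ((((∑ l, k l : ℕ) : ℤ) - (n : ℤ)) * ((∑ l, m l : ℕ) : ℤ)) *
          ∏ i, ∏ l,
            (qPoch (q * (x i * z l)) q (m l) / qPoch (x i * z l) q (m l)) *
            (qPoch (q * (z l / x i)) q (m l) / qPoch (z l / x i) q (m l)) := by
  change signSide q x z k = boxSide q x z k
  let φ := paramHom q x z
  let ι := algebraMap (ParamRing n s) (FractionRing (ParamRing n s))
  have sq : HasValue φ (ι paramQ) q := by
    simpa [φ] using HasValue.of_map (F := FractionRing (ParamRing n s)) (φ := φ) paramQ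
  have sx : ∀ i, HasValue φ (ι (paramX i)) (x i) := fun i => by
    simpa [φ] using HasValue.of_map (F := FractionRing (ParamRing n s)) (φ := φ) (paramX i)
  have sz : ∀ l, HasValue φ (ι (paramZ l)) (z l) := fun l => by
    simpa [φ] using HasValue.of_map (F := FractionRing (ParamRing n s)) (φ := φ) (paramZ l)
  have h0 : ∀ a b : Fin s, ι (paramZ a) * ι (paramZ b) ≠ 1 := fun a b h => by
    rw [← map_one ι, ← map_mul] at h
    simpa using paramHom_congr h 1 1 0
  -- Both sides over K are to be values of one and the same fraction, which the generic identity
  -- then rewrites.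
  refine (HasValue.signSide (k := k) sq sx sz hk hx hxsq hxx hzx).unique ?_
  rw [signSide_eq_boxSide generic_param h0]
  exact HasValue.boxSide sq sx sz hq hx hz hzx hzz hzne hzdiv hneg
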